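/- Conventions. For a finite set $V$, let $V^{(3)}$ be the family of all $3$-element subsets of $V$. A $3$-graph $G$ consists of a finite vertex set $V(G)$ and an edge set $E(G)\subseteq V(G)^{(3)}$; $H$ is a subgraph of $G$ if $V(H)\subseteq V(G)$ and $E(H)\subseteq E(G)$. Write $[n]=\{1,\dots,n\}$, and let $[n]^{(3)}$ also denote the complete $3$-graph on the vertex set $[n]$. A clique of order $t$ in $G$ is a subgraph of $G$ of the form $(T,T^{(3)})$ with $|T|=t$. The Lagrangian of $G$ is $$\lambda(G)=\max\Big\{\sum_{\{i,j,k\}\in E(G)}x_ix_jx_k \;:\; x_v\ge 0 \text{ for all } v\in V(G),\ \sum_{v\in V(G)}x_v=1\Big\}.$$ A $3$-graph $G$ with vertex set $[n]$ is left-compressed if, whenever $j_1<j_2<j_3$ form an edge of $G$ and $i_1<i_2<i_3$ are elements of $[n]$ with $i_p\le j_p$ for $p=1,2,3$, then $\{i_1,i_2,i_3\}$ is also an edge of $G$. Theorem 1.9. Let $l$ be a positive integer. Suppose that $\lambda(G)<\lambda([l-1]^{(3)})$ holds for every left-compressed $3$-graph $G$ on the vertex set $[l]$ that has exactly $\binom{l-1}{3}+\binom{l-2}{2}$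 edges and does not contain $[l-1]^{(3)}$ as a subgraph. Then for every positive integer $m$ with $$\binom{l-1}{3}\le m\le\binom{l-1}{3}+\binom{l-2}{2}$$ and every $3$-graph $G$ with $m$ edges that contains no clique of order $l-1$, one has $\lambda(G)<\lambda([l-1]^{(3)})$. -/

import Mathlib

universe u

/-- An `r`-uniform graph with a finite vertex set `verts` (of elements of `α`) and an edge set
consisting of `r`-element subsets of the vertex set. -/
structure RGraph (r : ℕ) (α : Type u) where
  verts : Finset α
  edges : Finset (Finset α)
  edges_sub : edges ⊆ verts.powersetCard r

namespace RGraph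

variable {r : ℕ} {α : Type u}

/-- `H` is a subgraph of `G`. -/
def IsSubgraph (H G : RGraph r α) : Prop :=
  H.verts ⊆ G.verts ∧ H.edges ⊆ G.edges

/-- The complete `r`-graph `V^(r)` on the vertex set `V`. -/
def complete (r : ℕ) (V : Finset α) : RGraph r α where
  verts := V
  edges := V.powersetCard r
  edges_sub := Finset.Subset.refl _

/-- The complete `r`-graph `[n]^(r)` on the vertex set `[n] = {1, …, n}`. -/
def initial (r n : ℕ) : RGraph r ℕ :=
  complete r (Finset.Icc 1 n)

/-- `G` contains a clique of order `t`: a complete `r`-graph on `t` vertices as a subgraph. -/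
def HasClique (G : RGraph r α) (t : ℕ) : Prop :=
  ∃ V : Finset α, V.card = t ∧ (complete r V).IsSubgraph G

/-- The polynomial `λ(G, x)`: the sum over the edges of the products of the weights. -/
def weightPoly (G : RGraph r α) (x : α → ℝ) : ℝ :=
  ∑ e ∈ G.edges, ∏ i ∈ e, x i

/-- The legal weightings of `G`: non-negative on the vertices, of total weight `1`.
(The values of `x` off the vertex set play no role.) -/
def weightings (G : RGraph r α) : Set (α → ℝ) :=
  {x | (∀ i ∈ G.verts, 0 ≤ x i) ∧ ∑ i ∈ G.verts, x i = 1}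

/-- The Lagrangian `λ(G)`: the maximum of `λ(G, x)` over the legal weightings. The supremum is
attained, by compactness of the simplex, as soon as `G` has a vertex. -/
noncomputable def lagrangian (G : RGraph r α) : ℝ :=
  sSup (G.weightPoly '' G.weightings)

/-- An `r`-graph of positive integers is left-compressed if `j₁ < ⋯ < jᵣ` being an edge implies
that `i₁ < ⋯ < iᵣ` is an edge, for all vertices `i₁, …, iᵣ` with `iₚ ≤ jₚ` for every `p`. -/
def LeftCompressed (G : RGraph r ℕ) : Prop :=
  ∀ i j : Fin r → ℕ, StrictMono i → StrictMono j → (∀ p, i p ∈ G.verts) → (∀ p, i p ≤ j p) →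
    Finset.univ.image j ∈ G.edges → Finset.univ.image i ∈ G.edges

end RGraph

/-!
Let `m = (l-1).choose 3 + (l-2).choose 2`. Among all pairs of a family of at most `m` triples and a
point of the simplex, take one of maximal weight and then of minimal support, so that any two
vertices of the support lie in a common edge (Frankl–Rödl). The support has at least `l - 1`
vertices: otherwise the complete family on the support and one further vertex would still have at
most `m` edges, and moving weight to that vertex would increase its polynomial.

Suppose the support has `k ≥ l` vertices; order it by decreasing weight, with lightest vertices `⊤`
and `u`. Compressions cannot decrease the weight, and they preserve the existence of an edge with
two vertices of weight less than `x u + x ⊤`. In an extremal family such an edge forces `u` and `⊤`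
to lie in a common edge, so the family may be taken left-compressed with this property. If there
were fewer than `(k-1).choose 3` edges, then more triples avoiding `⊤` would be missing than there
are edges at `⊤`; moving the weight of `⊤` to `u`, which makes the edges at `⊤` worthless, and
putting missing triples in their place would increase the weight. Hence `k = l`. If no triple
avoiding `⊤` were missing, there would be more than `m` edges; so the family does not contain
`[l-1]^(3)`, and the hypothesis bounds its weight.

Otherwise the support of every such pair has exactly `l - 1` vertices, and on `l - 1` vertices the
value `λ([l-1]^(3))` is attained only by the complete family, that is, by a clique.
-/

namespace HypergraphLagrangian

open Finset

/-! ### Lagrangian polynomials of set families -/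

section Weight

variable {V : Type*}

/-- The Lagrangian polynomial `λ(E, x)` of a family of finite sets. -/
def weight (E : Finset (Finset V)) (x : V → ℝ) : ℝ := ∑ e ∈ E, ∏ i ∈ e, x i

lemma continuous_weight (E : Finset (Finset V)) : Continuous (weight E) := by
  unfold weight
  fun_prop

lemma weight_congr {E : Finset (Finset V)} {x y : V → ℝ} (h : ∀ e ∈ E, ∀ i ∈ e, x i = y i) :
    weight E x = weight E y :=
  sum_congr rfl fun e he => prod_congr rfl (h e he)

lemma weight_nonneg {E : Finset (Finset V)} {x : V → ℝ} (hx : ∀ i, 0 ≤ x i) : 0 ≤ weight E x :=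
  sum_nonneg fun _ _ => prod_nonneg fun i _ => hx i

lemma weight_mono {E F : Finset (Finset V)} (h : E ⊆ F) {x : V → ℝ} (hx : ∀ i, 0 ≤ x i) :
    weight E x ≤ weight F x :=
  sum_le_sum_of_subset_of_nonneg h fun _ _ _ => prod_nonneg fun i _ => hx i

lemma prod_le_weight {E : Finset (Finset V)} {x : V → ℝ} (hx : ∀ i, 0 ≤ x i) {e : Finset V}
    (he : e ∈ E) : ∏ i ∈ e, x i ≤ weight E x :=
  single_le_sum (f := fun e => ∏ i ∈ e, x i) (fun _ _ => prod_nonneg fun i _ => hx i) he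

end Weight

section Link

variable {V : Type*} [DecidableEq V]

lemma weight_insert {E : Finset (Finset V)} {e : Finset V} (he : e ∉ E) (x : V → ℝ) :
    weight (insert e E) x = ∏ i ∈ e, x i + weight E x := sum_insert he

lemma weight_union {E F : Finset (Finset V)} (h : Disjoint E F) (x : V → ℝ) :
    weight (E ∪ F) x = weight E x + weight F x := sum_union h

lemma weight_image_insert {E : Finset (Finset V)} {a : V} (h : ∀ s ∈ E, a ∉ s) (x : V → ℝ) :
    weight (E.image (insert a)) x = x a * weight E x := by
  rw [weight, sum_image ((insert_erase_invOn.2.injOn).mono h), weight, mul_sum]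
  exact sum_congr rfl fun s hs => prod_insert (h s hs)

lemma weight_eq_nonMember_add_member (E : Finset (Finset V)) (x : V → ℝ) (a : V) :
    weight E x = weight (E.nonMemberSubfamily a) x + x a * weight (E.memberSubfamily a) x := by
  rw [← weight_image_insert (fun s hs => (mem_memberSubfamily.1 hs).2),
    image_insert_memberSubfamily, nonMemberSubfamily, add_comm]
  exact (sum_filter_add_sum_filter_not E (a ∈ ·) _).symm

lemma memberSubfamily_comm (E : Finset (Finset V)) (a b : V) :
    (E.memberSubfamily a).memberSubfamily b = (E.memberSubfamily b).memberSubfamily a := by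
  ext s
  simp only [mem_memberSubfamily, mem_insert, insert_comm a b]
  grind

lemma memberSubfamily_nonMemberSubfamily_comm (E : Finset (Finset V)) {a b : V} (hab : a ≠ b) :
    (E.memberSubfamily a).nonMemberSubfamily b = (E.nonMemberSubfamily b).memberSubfamily a := by
  ext s
  simp only [mem_memberSubfamily, mem_nonMemberSubfamily, mem_insert]
  grind

/-- The coefficient of `x a * x b` in `weight E x`, that is, the polynomial of the common link
of `a` and `b`. -/
def pairWeight (E : Finset (Finset V)) (x : V → ℝ) (a b : V) : ℝ :=
  weight ((E.memberSubfamily a).memberSubfamily b) x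

lemma pairWeight_comm (E : Finset (Finset V)) (x : V → ℝ) (a b : V) :
    pairWeight E x a b = pairWeight E x b a := by
  rw [pairWeight, memberSubfamily_comm, pairWeight]

lemma pairWeight_nonneg {E : Finset (Finset V)} {x : V → ℝ} (hx : ∀ i, 0 ≤ x i) (a b : V) :
    0 ≤ pairWeight E x a b := weight_nonneg hx

lemma weight_memberSubfamily_eq (E : Finset (Finset V)) (x : V → ℝ) (a b : V) :
    weight (E.memberSubfamily a) x =
      weight ((E.memberSubfamily a).nonMemberSubfamily b) x + x b * pairWeight E x a b :=
  weight_eq_nonMember_add_member _ x b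

/-- The sets extended to an edge by `a` but not by `b`: the family `E_{a∖b}` in the usual notation
for Lagrangians. -/
def excess (E : Finset (Finset V)) (a b : V) : Finset (Finset V) :=
  (E.memberSubfamily a).nonMemberSubfamily b \ (E.memberSubfamily b).nonMemberSubfamily a

lemma mem_excess {E : Finset (Finset V)} {a b : V} {s : Finset V} :
    s ∈ excess E a b ↔ a ∉ s ∧ b ∉ s ∧ insert a s ∈ E ∧ insert b s ∉ E := by
  simp only [excess, mem_sdiff, mem_nonMemberSubfamily, mem_memberSubfamily]
  tauto

lemma weight_memberSubfamily_sub (E : Finset (Finset V)) (x : V → ℝ) (a b : V) :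
    weight (E.memberSubfamily a) x - weight (E.memberSubfamily b) x =
      (x b - x a) * pairWeight E x a b + (weight (excess E a b) x - weight (excess E b a) x) := by
  have hexcess : weight (excess E a b) x - weight (excess E b a) x =
      weight ((E.memberSubfamily a).nonMemberSubfamily b) x -
        weight ((E.memberSubfamily b).nonMemberSubfamily a) x := sum_sdiff_sub_sum_sdiff
  rw [hexcess, weight_memberSubfamily_eq E x a b, weight_memberSubfamily_eq E x b a,
    pairWeight_comm E x b a]
  ring

end Link

section Transfer

variable {V : Type*} [DecidableEq V]

/-- The weighting `x` with weight `t` moved from `b` to `a`. -/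
def transfer (x : V → ℝ) (a b : V) (t : ℝ) : V → ℝ := x + Pi.single a t - Pi.single b t

lemma transfer_left {a b : V} (hab : a ≠ b) (x : V → ℝ) (t : ℝ) :
    transfer x a b t a = x a + t := by
  simp [transfer, hab]

lemma transfer_right {a b : V} (hab : a ≠ b) (x : V → ℝ) (t : ℝ) :
    transfer x a b t b = x b - t := by
  simp [transfer, hab.symm]

lemma transfer_of_ne {a b i : V} (ha : i ≠ a) (hb : i ≠ b) (x : V → ℝ) (t : ℝ) :
    transfer x a b t i = x i := by
  simp [transfer, ha, hb]

lemma transfer_mem_stdSimplex [Fintype V] {a b : V} (hab : a ≠ b) {x : V → ℝ}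
    (hx : x ∈ stdSimplex ℝ V) {t : ℝ} (hat : -x a ≤ t) (htb : t ≤ x b) :
    transfer x a b t ∈ stdSimplex ℝ V := by
  refine ⟨fun i => ?_, ?_⟩
  · by_cases hia : i = a
    · rw [hia, transfer_left hab]
      linarith
    by_cases hib : i = b
    · rw [hib, transfer_right hab]
      linarith
    · rw [transfer_of_ne hia hib]
      exact hx.1 i
  · simpa [transfer, sum_add_distrib] using hx.2

lemma weight_eq_of_ne (E : Finset (Finset V)) (x : V → ℝ) {a b : V} (hab : a ≠ b) :
    weight E x = weight ((E.nonMemberSubfamily a).nonMemberSubfamily b) x +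
      x a * weight ((E.memberSubfamily a).nonMemberSubfamily b) x +
      x b * weight ((E.memberSubfamily b).nonMemberSubfamily a) x +
      x a * x b * pairWeight E x a b := by
  rw [weight_eq_nonMember_add_member E x a, weight_memberSubfamily_eq E x a b,
    weight_eq_nonMember_add_member (E.nonMemberSubfamily a) x b,
    memberSubfamily_nonMemberSubfamily_comm E hab.symm]
  ring

lemma weight_transfer_of_notMem {F : Finset (Finset V)} {a b : V} (ha : ∀ s ∈ F, a ∉ s)
    (hb : ∀ s ∈ F, b ∉ s) (x : V → ℝ) (t : ℝ) : weight F (transfer x a b t) = weight F x :=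
  weight_congr fun s hs _ hi =>
    transfer_of_ne (ne_of_mem_of_not_mem hi (ha s hs)) (ne_of_mem_of_not_mem hi (hb s hs)) x t

lemma weight_transfer {a b : V} (hab : a ≠ b) (E : Finset (Finset V)) (x : V → ℝ) (t : ℝ) :
    weight E (transfer x a b t) = weight E x +
      t * (weight (E.memberSubfamily a) x - weight (E.memberSubfamily b) x) -
      t ^ 2 * pairWeight E x a b := by
  have hnone := weight_transfer_of_notMem (F := (E.nonMemberSubfamily a).nonMemberSubfamily b)
    (a := a) (b := b) (by simp +contextual) (by simp +contextual) x t
  have hleft := weight_transfer_of_notMem (F := (E.memberSubfamily a).nonMemberSubfamily b)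
    (a := a) (b := b) (by simp +contextual) (by simp +contextual) x t
  have hright := weight_transfer_of_notMem (F := (E.memberSubfamily b).nonMemberSubfamily a)
    (a := a) (b := b) (by simp +contextual) (by simp +contextual) x t
  have hboth : pairWeight E (transfer x a b t) a b = pairWeight E x a b :=
    weight_transfer_of_notMem (by simp +contextual) (by simp +contextual) x t
  rw [weight_eq_of_ne E _ hab, weight_eq_of_ne E x hab, hnone, hleft, hright, hboth,
    transfer_left hab, transfer_right hab, weight_memberSubfamily_eq E x a b,
    weight_memberSubfamily_eq E x b a, pairWeight_comm E x b a]
  ring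

end Transfer

/-! ### Extremal pairs -/

section Extremal

variable {V : Type*} [Fintype V]

/-- `(E, x)` maximises the Lagrangian polynomial among all pairs of an `r`-uniform family with at
most `m` edges and a point of the simplex. -/
structure IsExtremal (r m : ℕ) (E : Finset (Finset V)) (x : V → ℝ) : Prop where
  sized : (E : Set (Finset V)).Sized r
  card_le : #E ≤ m
  mem_stdSimplex : x ∈ stdSimplex ℝ V
  weight_le : ∀ F : Finset (Finset V), (F : Set (Finset V)).Sized r → #F ≤ m →
    ∀ y ∈ stdSimplex ℝ V, weight F y ≤ weight E x

lemma exists_isExtremal [Nonempty V] (r m : ℕ) :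
    ∃ (E : Finset (Finset V)) (x : V → ℝ), IsExtremal r m E x := by
  classical
  have hne : (stdSimplex ℝ V).Nonempty := ⟨_, single_mem_stdSimplex ℝ (Classical.arbitrary V)⟩
  choose X hX hXmax using fun E : Finset (Finset V) =>
    (isCompact_stdSimplex ℝ V).exists_isMaxOn hne (continuous_weight E).continuousOn
  let 𝓔 : Finset (Finset (Finset V)) := {E | (E : Set (Finset V)).Sized r ∧ #E ≤ m}
  obtain ⟨E, hE, hEmax⟩ :=
    𝓔.exists_max_image (fun E => weight E (X E)) ⟨∅, by simp [𝓔, Set.Sized]⟩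
  simp only [𝓔, mem_filter, mem_univ, true_and] at hE hEmax
  exact ⟨E, X E, hE.1, hE.2, hX E, fun F hF hm y hy => (hXmax F hy).trans (hEmax F ⟨hF, hm⟩)⟩

/-- The set of vertices of positive weight. -/
noncomputable def positiveSupport (x : V → ℝ) : Finset V := {i | 0 < x i}

lemma mem_positiveSupport {x : V → ℝ} {i : V} : i ∈ positiveSupport x ↔ 0 < x i := by
  simp [positiveSupport]

lemma eq_zero_of_notMem_positiveSupport {x : V → ℝ} (hx : ∀ i, 0 ≤ x i) {i : V}
    (hi : i ∉ positiveSupport x) : x i = 0 :=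
  le_antisymm (not_lt.1 (mt mem_positiveSupport.2 hi)) (hx i)

/-- Any two vertices of positive weight lie in a common edge all of whose vertices have positive
weight. -/
def PairCovered (E : Finset (Finset V)) (x : V → ℝ) : Prop :=
  ∀ a b, a ≠ b → 0 < x a → 0 < x b → ∃ e ∈ E, a ∈ e ∧ b ∈ e ∧ ∀ i ∈ e, 0 < x i

namespace IsExtremal

variable {r m : ℕ} {E : Finset (Finset V)} {x : V → ℝ}

lemma nonneg (h : IsExtremal r m E x) (i : V) : 0 ≤ x i := h.mem_stdSimplex.1 i

lemma weight_eq (h : IsExtremal r m E x) {F : Finset (Finset V)} {y : V → ℝ}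
    (hF : IsExtremal r m F y) : weight E x = weight F y :=
  le_antisymm (hF.weight_le E h.sized h.card_le x h.mem_stdSimplex)
    (h.weight_le F hF.sized hF.card_le y hF.mem_stdSimplex)

lemma of_weight_le (h : IsExtremal r m E x) {F : Finset (Finset V)} {y : V → ℝ}
    (hF : (F : Set (Finset V)).Sized r) (hm : #F ≤ m) (hy : y ∈ stdSimplex ℝ V)
    (hle : weight E x ≤ weight F y) : IsExtremal r m F y :=
  ⟨hF, hm, hy, fun K hK hKm z hz => (h.weight_le K hK hKm z hz).trans hle⟩

end IsExtremal

end Extremal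

section FirstOrder

variable {V : Type*} [DecidableEq V] [Fintype V] {r m : ℕ} {E : Finset (Finset V)} {x : V → ℝ}

namespace IsExtremal

lemma weight_link_le (h : IsExtremal r m E x) {a b : V} (hab : a ≠ b) (hb : 0 < x b) :
    weight (E.memberSubfamily a) x ≤ weight (E.memberSubfamily b) x := by
  by_contra! hlt
  set A := weight (E.memberSubfamily a) x - weight (E.memberSubfamily b) x with hA
  have hApos : 0 < A := sub_pos.2 hlt
  set S := pairWeight E x a b with hS
  have hS0 : 0 ≤ S := pairWeight_nonneg h.nonneg a b
  set t := min (x b) (A / (2 * (S + 1)))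
  have ht : 0 < t := lt_min hb (by positivity)
  have htA : t * (2 * (S + 1)) ≤ A := by
    rw [← le_div_iff₀ (by positivity)]
    exact min_le_right _ _
  have hmax := h.weight_le E h.sized h.card_le (transfer x a b t)
    (transfer_mem_stdSimplex hab h.mem_stdSimplex (by linarith [h.nonneg a]) (min_le_left _ _))
  rw [weight_transfer hab, ← hA, ← hS] at hmax
  nlinarith [mul_pos ht hApos, mul_nonneg ht.le hS0, mul_le_mul_of_nonneg_left htA ht.le]

lemma weight_link_eq (h : IsExtremal r m E x) {a b : V} (hab : a ≠ b) (ha : 0 < x a)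
    (hb : 0 < x b) : weight (E.memberSubfamily a) x = weight (E.memberSubfamily b) x :=
  le_antisymm (h.weight_link_le hab hb) (h.weight_link_le hab.symm ha)

lemma weight_transfer_eq (h : IsExtremal r m E x) {a b : V} (hab : a ≠ b) (ha : 0 < x a)
    (hb : 0 < x b) (t : ℝ) :
    weight E (transfer x a b t) = weight E x - t ^ 2 * pairWeight E x a b := by
  rw [weight_transfer hab, h.weight_link_eq hab ha hb]
  ring

lemma sub_mul_pairWeight (h : IsExtremal r m E x) {a b : V} (hab : a ≠ b) (ha : 0 < x a)
    (hb : 0 < x b) :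
    (x a - x b) * pairWeight E x a b = weight (excess E a b) x - weight (excess E b a) x := by
  have hsub := weight_memberSubfamily_sub E x a b
  rw [h.weight_link_eq hab ha hb] at hsub
  linarith

lemma transfer_of_pairWeight_eq_zero (h : IsExtremal r m E x) {a b : V} (hab : a ≠ b)
    (ha : 0 < x a) (hb : 0 < x b) (hzero : pairWeight E x a b = 0) {t : ℝ} (hat : -x a ≤ t)
    (htb : t ≤ x b) : IsExtremal r m E (transfer x a b t) :=
  h.of_weight_le h.sized h.card_le (transfer_mem_stdSimplex hab h.mem_stdSimplex hat htb)
    (by rw [h.weight_transfer_eq hab ha hb, hzero]; linarith)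

end IsExtremal

end FirstOrder

section Exchange

variable {V : Type*} [DecidableEq V]

lemma weight_insert_erase {E : Finset (Finset V)} {e f : Finset V} (he : e ∈ E) (hf : f ∉ E)
    (x : V → ℝ) :
    weight (insert f (E.erase e)) x = weight E x - ∏ i ∈ e, x i + ∏ i ∈ f, x i := by
  rw [weight_insert fun hmem => hf (mem_of_mem_erase hmem), weight, weight,
    ← add_sum_erase E _ he]
  ring

lemma sized_insert {r : ℕ} {E : Finset (Finset V)} (hE : (E : Set (Finset V)).Sized r)
    {f : Finset V} (hf : #f = r) : ((insert f E : Finset (Finset V)) : Set (Finset V)).Sized r := by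
  rw [coe_insert]
  rintro s (rfl | hs)
  exacts [hf, hE hs]

variable [Fintype V] {r m : ℕ} {E : Finset (Finset V)} {x : V → ℝ}

namespace IsExtremal

lemma sized_insert_erase (h : IsExtremal r m E x) (e : Finset V) {f : Finset V} (hf : #f = r) :
    ((insert f (E.erase e) : Finset (Finset V)) : Set (Finset V)).Sized r :=
  sized_insert (h.sized.mono (coe_subset.2 (erase_subset e E))) hf

lemma card_insert_erase_le (h : IsExtremal r m E x) {e : Finset V} (he : e ∈ E) (f : Finset V) :
    #(insert f (E.erase e)) ≤ m :=
  (card_insert_le _ _).trans ((card_erase_add_one he).trans_le h.card_le)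

omit [DecidableEq V] in
lemma prod_le_prod_of_notMem (h : IsExtremal r m E x) {e f : Finset V} (he : e ∈ E) (hf : f ∉ E)
    (hcard : #f = r) : ∏ i ∈ f, x i ≤ ∏ i ∈ e, x i := by
  classical
  have hmax := h.weight_le _ (h.sized_insert_erase e hcard) (h.card_insert_erase_le he f) x
    h.mem_stdSimplex
  rw [weight_insert_erase he hf] at hmax
  linarith

lemma exchange (h : IsExtremal r m E x) {e f : Finset V} (he : e ∈ E) (hf : f ∉ E)
    (hcard : #f = r) (hprod : ∏ i ∈ f, x i = ∏ i ∈ e, x i) :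
    IsExtremal r m (insert f (E.erase e)) x :=
  h.of_weight_le (h.sized_insert_erase e hcard) (h.card_insert_erase_le he f) h.mem_stdSimplex
    (by rw [weight_insert_erase he hf, hprod]; linarith)

lemma card_insert_eq (h : IsExtremal r m E x) {i j : V} {s : Finset V} (hi : i ∉ s) (hj : j ∉ s)
    (his : insert i s ∈ E) : #(insert j s) = r := by
  rw [card_insert_of_notMem hj, ← card_insert_of_notMem hi, h.sized his]

lemma le_of_insert_notMem (h : IsExtremal r m E x) {i j : V} {s : Finset V} (hi : i ∉ s)
    (hj : j ∉ s) (his : insert i s ∈ E) (hjs : insert j s ∉ E) (hpos : ∀ w ∈ s, 0 < x w) :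
    x j ≤ x i := by
  have hle := h.prod_le_prod_of_notMem his hjs (h.card_insert_eq hi hj his)
  rw [prod_insert hi, prod_insert hj] at hle
  exact le_of_mul_le_mul_right hle (prod_pos hpos)

omit [DecidableEq V] in
lemma card_eq (h : IsExtremal r m E x) (hpos : ∀ i, 0 < x i)
    (hm : m < (Fintype.card V).choose r) : #E = m := by
  classical
  refine h.card_le.eq_of_not_lt fun hlt => ?_
  obtain ⟨f, hf, hfE⟩ : ∃ f ∈ univ.powersetCard r, f ∉ E :=
    exists_mem_notMem_of_card_lt_card (by simpa using hlt.trans hm)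
  have hmax := h.weight_le (insert f E) (sized_insert h.sized (mem_powersetCard.1 hf).2)
    ((card_insert_le _ _).trans hlt) x h.mem_stdSimplex
  rw [weight_insert hfE] at hmax
  linarith [prod_pos (s := f) fun i _ => hpos i]

end IsExtremal

end Exchange

section Support

variable {V : Type*} [DecidableEq V] {r m : ℕ} {E : Finset (Finset V)} {x : V → ℝ}

omit [DecidableEq V] in
lemma weight_le_weight_powersetCard (hE : (E : Set (Finset V)).Sized r) (hx : ∀ i, 0 ≤ x i)
    {S : Finset V} (hS : ∀ i ∉ S, x i = 0) : weight E x ≤ weight (S.powersetCard r) x := by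
  classical
  have hsupp : weight E x = weight {e ∈ E | e ⊆ S} x := by
    refine (sum_filter_of_ne fun e _ hne i hi => ?_).symm
    by_contra hiS
    exact hne (prod_eq_zero hi (hS i hiS))
  rw [hsupp]
  refine weight_mono (fun e he => ?_) hx
  rw [mem_filter] at he
  exact mem_powersetCard.2 ⟨he.2, hE he.1⟩

lemma excess_powersetCard_eq_empty {S : Finset V} {q : V} (hq : q ∈ S) (p : V) :
    excess (S.powersetCard r) p q = ∅ := by
  refine eq_empty_of_forall_notMem fun s hs => ?_
  obtain ⟨hps, hqs, hp, hqS⟩ := mem_excess.1 hs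
  rw [mem_powersetCard, insert_subset_iff, card_insert_of_notMem hps] at hp
  exact hqS (mem_powersetCard.2 ⟨insert_subset hq hp.1.2, by rw [card_insert_of_notMem hqs, hp.2]⟩)

lemma pairWeight_eq_zero_of_forall (hx : ∀ i, 0 ≤ x i) {a b : V} (ha : 0 < x a) (hb : 0 < x b)
    (h : ∀ e ∈ E, a ∈ e → b ∈ e → ∃ i ∈ e, x i ≤ 0) : pairWeight E x a b = 0 := by
  refine sum_eq_zero fun s hs => ?_
  simp only [mem_memberSubfamily] at hs
  obtain ⟨i, hi, hxi⟩ := h _ hs.1.1 (mem_insert_self _ _) (mem_insert_of_mem (mem_insert_self _ _))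
  have his : i ∈ s := by grind
  exact prod_eq_zero his (hxi.antisymm (hx i))

variable [Fintype V]

lemma positiveSupport_transfer_ssubset {a b : V} (hab : a ≠ b) (ha : 0 < x a) (hb : 0 < x b) :
    positiveSupport (transfer x a b (x b)) ⊂ positiveSupport x := by
  refine (ssubset_iff_of_subset fun i hi => ?_).2 ⟨b, mem_positiveSupport.2 hb, ?_⟩
  · by_cases hia : i = a
    · exact mem_positiveSupport.2 (hia ▸ ha)
    by_cases hib : i = b
    · exact mem_positiveSupport.2 (hib ▸ hb)
    · rwa [mem_positiveSupport, transfer_of_ne hia hib, ← mem_positiveSupport] at hi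
  · simp [mem_positiveSupport, transfer_right hab]

namespace IsExtremal

omit [DecidableEq V] in
lemma exists_pairCovered (h : IsExtremal r m E x) : ∃ y, IsExtremal r m E y ∧ PairCovered E y := by
  classical
  induction hk : #(positiveSupport x) using Nat.strong_induction_on generalizing x with
  | _ k ih =>
  by_cases hc : PairCovered E x
  · exact ⟨x, h, hc⟩
  simp only [PairCovered] at hc
  push Not at hc
  obtain ⟨a, b, hab, ha, hb, hno⟩ := hc
  have hzero := pairWeight_eq_zero_of_forall h.nonneg ha hb hno
  have hext := h.transfer_of_pairWeight_eq_zero hab ha hb hzero (by linarith) le_rfl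
  exact ih _ (hk ▸ card_lt_card (positiveSupport_transfer_ssubset hab ha hb)) hext rfl

end IsExtremal

omit [DecidableEq V] in
lemma exists_edge_subset_positiveSupport (hx : ∀ i, 0 ≤ x i) (hE : 0 < weight E x) :
    ∃ e ∈ E, e ⊆ positiveSupport x := by
  obtain ⟨e, he, hne⟩ := exists_ne_zero_of_sum_ne_zero hE.ne'
  exact ⟨e, he, fun i hi =>
    mem_positiveSupport.2 ((hx i).lt_of_ne' (prod_ne_zero_iff.1 hne i hi))⟩

lemma exists_pairWeight_powersetCard_pos (hr : 2 ≤ r) (hx : ∀ i, 0 ≤ x i) {e : Finset V}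
    (he : #e = r) (hpos : e ⊆ positiveSupport x) {w : V} (hw : w ∉ positiveSupport x) :
    ∃ a ∈ positiveSupport x,
      0 < pairWeight ((insert w (positiveSupport x)).powersetCard r) x w a := by
  obtain ⟨a, ha, b, hb, hab⟩ := one_lt_card.1 (he ▸ hr : 1 < #e)
  have hwe : w ∉ e := fun hmem => hw (hpos hmem)
  set s := (e.erase b).erase a
  have hs : s ⊆ e := (erase_subset _ _).trans (erase_subset _ _)
  have hinsert : insert a s = e.erase b := insert_erase (mem_erase.2 ⟨hab, ha⟩)
  have hwa : w ∉ insert a s := hinsert ▸ fun hmem => hwe (mem_of_mem_erase hmem)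
  have hmem : s ∈ (((insert w (positiveSupport x)).powersetCard r).memberSubfamily
      w).memberSubfamily a := by
    refine mem_memberSubfamily.2 ⟨mem_memberSubfamily.2 ⟨mem_powersetCard.2 ⟨?_, ?_⟩, hwa⟩,
      notMem_erase _ _⟩
    · exact insert_subset_insert _ (hinsert ▸ (erase_subset _ _).trans hpos)
    · rw [card_insert_of_notMem hwa, hinsert, card_erase_add_one hb, he]
  refine ⟨a, hpos ha, (prod_pos fun i hi => ?_).trans_le (prod_le_weight hx hmem)⟩
  exact mem_positiveSupport.1 (hpos (hs hi))

omit [DecidableEq V] in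
/-- Otherwise the complete family on the support and one further vertex `w` is extremal too, yet
moving weight to `w` increases its polynomial. -/
lemma IsExtremal.le_card_positiveSupport (h : IsExtremal r m E x) (hr : 2 ≤ r) {n : ℕ}
    (hn : n.choose r ≤ m) (hV : n ≤ Fintype.card V) (hE : 0 < weight E x) :
    n ≤ #(positiveSupport x) := by
  classical
  by_contra! hlt
  set P := positiveSupport x
  obtain ⟨w, -, hw⟩ : ∃ w ∈ univ, w ∉ P :=
    exists_mem_notMem_of_card_lt_card (by simpa using hlt.trans_le hV)
  set K := (insert w P).powersetCard r with hK
  have hKm : #K ≤ m := by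
    rw [hK, card_powersetCard, card_insert_of_notMem hw]
    exact (Nat.choose_le_choose r hlt).trans hn
  have hKext : IsExtremal r m K x :=
    h.of_weight_le (Set.sized_powersetCard _ _) hKm h.mem_stdSimplex
      (weight_le_weight_powersetCard h.sized h.nonneg fun i hi =>
        eq_zero_of_notMem_positiveSupport h.nonneg fun hiP => hi (mem_insert_of_mem hiP))
  obtain ⟨e, he, heP⟩ := exists_edge_subset_positiveSupport h.nonneg hE
  obtain ⟨a, haP, hpair⟩ := exists_pairWeight_powersetCard_pos hr h.nonneg (h.sized he) heP hw
  have hwa : w ≠ a := fun hwa => hw (hwa ▸ haP)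
  have hxa : 0 < x a := mem_positiveSupport.1 haP
  have hsub := weight_memberSubfamily_sub K x w a
  rw [excess_powersetCard_eq_empty (mem_insert_of_mem haP),
    eq_zero_of_notMem_positiveSupport h.nonneg hw,
    excess_powersetCard_eq_empty (mem_insert_self w P), sub_self, add_zero, sub_zero] at hsub
  linarith [hKext.weight_link_le hwa hxa, mul_pos hxa hpair]

end Support

/-! ### Compression -/

section Shifting

variable {V : Type*} [DecidableEq V] [Fintype V] {r m : ℕ} {E : Finset (Finset V)} {x : V → ℝ}

namespace IsExtremal

/-- If no edge contains both `a` and `b`, then weight moves freely from `b` to `a`, making `a`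
heavier than `i` without leaving the extremal pairs. -/
lemma insert_mem_of_lt_add (h : IsExtremal r m E x) (hpos : ∀ i, 0 < x i) {a b : V} (hab : a ≠ b)
    (hno : ∀ e ∈ E, a ∈ e → b ∉ e) {i : V} (hia : i ≠ a) (hlt : x i < x a + x b) {s : Finset V}
    (hi : i ∉ s) (ha : a ∉ s) (his : insert i s ∈ E) : insert a s ∈ E := by
  by_contra has
  set t := (max 0 (x i - x a) + x b) / 2 with ht
  have hmax0 : (0 : ℝ) ≤ max 0 (x i - x a) := le_max_left _ _
  have hmax1 : x i - x a ≤ max 0 (x i - x a) := le_max_right _ _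
  have hmaxb : max 0 (x i - x a) < x b := max_lt (hpos b) (by linarith)
  have hzero : pairWeight E x a b = 0 :=
    pairWeight_eq_zero_of_forall h.nonneg (hpos a) (hpos b) fun e he hae hbe =>
      absurd hbe (hno e he hae)
  have hext := h.transfer_of_pairWeight_eq_zero hab (hpos a) (hpos b) hzero (t := t)
    (by linarith [hpos a, hpos b]) (by linarith)
  have hpos' : ∀ w ∈ s, 0 < transfer x a b t w := by
    intro w hw
    by_cases hwb : w = b
    · rw [hwb, transfer_right hab]
      linarith
    · rw [transfer_of_ne (ne_of_mem_of_not_mem hw ha) hwb]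
      exact hpos w
  have hle := hext.le_of_insert_notMem hi ha his has hpos'
  rw [transfer_left hab] at hle
  by_cases hib : i = b
  · rw [hib, transfer_right hab] at hle
    rw [hib] at hmax1
    linarith [hpos a]
  · rw [transfer_of_ne hia hib] at hle
    linarith

omit [DecidableEq V] in
lemma exists_mem_mem_of_light (h : IsExtremal r m E x) (hpos : ∀ i, 0 < x i) {a b : V}
    (hab : a ≠ b) (hlight : ∃ e ∈ E, 1 < #{i ∈ e | x i < x a + x b}) :
    ∃ e ∈ E, a ∈ e ∧ b ∈ e := by
  classical
  by_contra! hno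
  have hreplace : ∃ e ∈ E, a ∈ e ∧ ∃ j ∈ e, j ≠ a ∧ x j < x a + x b := by
    obtain ⟨e, he, hcard⟩ := hlight
    by_cases hae : a ∈ e
    · obtain ⟨j, hj, hja⟩ := exists_mem_ne hcard a
      rw [mem_filter] at hj
      exact ⟨e, he, hae, j, hj.1, hja, hj.2⟩
    · obtain ⟨i, hi, j, hj, hij⟩ := one_lt_card.1 hcard
      rw [mem_filter] at hi hj
      refine ⟨insert a (e.erase i), ?_, mem_insert_self _ _, j,
        mem_insert_of_mem (mem_erase.2 ⟨hij.symm, hj.1⟩), ne_of_mem_of_not_mem hj.1 hae, hj.2⟩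
      exact h.insert_mem_of_lt_add hpos hab hno (ne_of_mem_of_not_mem hi.1 hae) hi.2
        (notMem_erase _ _) (fun hmem => hae (mem_of_mem_erase hmem)) (by rwa [insert_erase hi.1])
  obtain ⟨e, he, hae, j, hj, hja, hlt⟩ := hreplace
  have hbe := hno e he hae
  refine hno (insert b (e.erase j)) ?_ (mem_insert_of_mem (mem_erase.2 ⟨hja.symm, hae⟩))
    (mem_insert_self _ _)
  exact h.insert_mem_of_lt_add hpos hab.symm (fun f hf hbf haf => hno f hf haf hbf)
    (ne_of_mem_of_not_mem hj hbe) (by rwa [add_comm]) (notMem_erase _ _)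
    (fun hmem => hbe (mem_of_mem_erase hmem)) (by rwa [insert_erase hj])

end IsExtremal

end Shifting

section Compressed

variable {V : Type*} [LinearOrder V]

/-- `E` is closed under replacing a vertex of an edge by a smaller one. -/
def Shifted (E : Finset (Finset V)) : Prop :=
  ∀ ⦃i j : V⦄, i < j → ∀ ⦃s : Finset V⦄, i ∉ s → j ∉ s → insert j s ∈ E → insert i s ∈ E

variable [Fintype V]

lemma card_filter_lt_strictMono : StrictMono fun i : V => #{j | j < i} := fun i k hik =>
  card_lt_card <| (ssubset_iff_of_subset
    (monotone_filter_right _ fun _ _ hj => hj.trans hik)).2 ⟨i, by simpa using hik, by simp⟩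

variable {r m : ℕ} {E : Finset (Finset V)} {x : V → ℝ}

/-- Among the extremal families for `x` having an edge with two vertices of weight below `c`, one
of least total rank is shifted. -/
lemma IsExtremal.exists_shifted (h : IsExtremal r m E x) (hpos : ∀ i, 0 < x i)
    (hanti : Antitone x) {c : ℝ} (hlight : ∃ e ∈ E, 1 < #{i ∈ e | x i < c}) :
    ∃ F, IsExtremal r m F x ∧ Shifted F ∧ ∃ e ∈ F, 1 < #{i ∈ e | x i < c} := by
  classical
  let rank (e : Finset V) : ℕ := ∑ i ∈ e, #{j | j < i}
  obtain ⟨F, hF, hmin⟩ := exists_min_image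
    {F : Finset (Finset V) | IsExtremal r m F x ∧ ∃ e ∈ F, 1 < #{i ∈ e | x i < c}}
    (fun F => ∑ e ∈ F, rank e) ⟨E, by simpa using ⟨h, hlight⟩⟩
  simp only [mem_filter, mem_univ, true_and] at hF hmin
  obtain ⟨hext, e, he, hcard⟩ := hF
  refine ⟨F, hext, fun i j hij s hi hj hjs => ?_, e, he, hcard⟩
  by_contra his
  have hxij : x i = x j :=
    le_antisymm (hext.le_of_insert_notMem hj hi hjs his fun w _ => hpos w) (hanti hij.le)
  have hlight' : ∃ e ∈ insert (insert i s) (F.erase (insert j s)), 1 < #{i ∈ e | x i < c} := by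
    by_cases hes : e = insert j s
    · refine ⟨insert i s, mem_insert_self _ _, ?_⟩
      rw [hes, filter_insert, ← hxij] at hcard
      rw [filter_insert]
      split_ifs at hcard ⊢ <;> simp_all
    · exact ⟨e, mem_insert_of_mem (mem_erase.2 ⟨hes, he⟩), hcard⟩
  have hle := hmin _ ⟨hext.exchange hjs his (hext.card_insert_eq hj hi hjs)
    (by rw [prod_insert hi, prod_insert hj, hxij]), hlight'⟩
  rw [sum_insert fun hmem => his (mem_of_mem_erase hmem), ← add_sum_erase F rank hjs,
    add_le_add_iff_right] at hle
  simp only [rank, sum_insert hi, sum_insert hj, add_le_add_iff_right] at hle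
  exact (card_filter_lt_strictMono hij).not_ge hle

/-- An extremal pair with positive weights, decreasing along the order, and a shifted family. -/
structure IsCompressedExtremal (r m : ℕ) (E : Finset (Finset V)) (x : V → ℝ) : Prop
    extends IsExtremal r m E x where
  pos : ∀ i, 0 < x i
  antitone : Antitone x
  shifted : Shifted E

lemma IsExtremal.exists_isCompressedExtremal (h : IsExtremal r m E x) (hpos : ∀ i, 0 < x i)
    (hanti : Antitone x) {a b : V} (hab : a ≠ b) (hcov : ∃ e ∈ E, a ∈ e ∧ b ∈ e) :
    ∃ F, IsCompressedExtremal r m F x ∧ ∃ e ∈ F, a ∈ e ∧ b ∈ e := by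
  obtain ⟨e, he, hae, hbe⟩ := hcov
  have hlight : 1 < #{i ∈ e | x i < x a + x b} :=
    one_lt_card.2 ⟨a, by simp [hae, hpos b], b, by simp [hbe, hpos a], hab⟩
  obtain ⟨F, hF, hshift, hlightF⟩ := h.exists_shifted hpos hanti ⟨e, he, hlight⟩
  exact ⟨F, ⟨hF, hpos, hanti, hshift⟩, hF.exists_mem_mem_of_light hpos hab hlightF⟩

end Compressed

/-! ### Density of compressed extremal families -/

section Averaging

lemma exists_subset_nsmul_sum_le {ι M : Type*} [AddCommMonoid M] [LinearOrder M]
    [IsOrderedAddMonoid M] (w : ι → M) {g : ℕ} (s : Finset ι) (hg : g ≤ #s) :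
    ∃ t ⊆ s, #t = g ∧ g • ∑ i ∈ s, w i ≤ #s • ∑ i ∈ t, w i := by
  classical
  induction hn : #s generalizing s with
  | zero => exact ⟨∅, by simp, by simp; omega, by simp [show g = 0 by omega]⟩
  | succ n ih =>
    rcases hg.eq_or_lt with hgs | hgs
    · exact ⟨s, subset_rfl, hgs.symm, by rw [← hn, hgs]⟩
    obtain ⟨a, ha, hmin⟩ := s.exists_min_image w (card_pos.1 (by omega))
    obtain ⟨t, hts, htg, hle⟩ :=
      ih (s.erase a) (by rw [card_erase_of_mem ha]; omega) (by rw [card_erase_of_mem ha]; omega)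
    refine ⟨t, hts.trans (erase_subset _ _), htg, ?_⟩
    have ha_le : g • w a ≤ ∑ i ∈ t, w i :=
      htg ▸ card_nsmul_le_sum t w (w a) fun i hi => hmin i (mem_of_mem_erase (hts hi))
    rw [← sum_erase_add s w ha, nsmul_add, succ_nsmul]
    exact add_le_add hle ha_le

lemma exists_subset_card_le_mul_sum_le {ι : Type*} {w : ι → ℝ} (hw : ∀ i, 0 ≤ w i) {g : ℕ}
    (hg : 0 < g) {s : Finset ι} {c R : ℝ} (hc : 0 ≤ c) (hcR : c ≤ R)
    (hs : c * #s ≤ g * R) :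
    ∃ t ⊆ s, #t ≤ g ∧ c * ∑ i ∈ s, w i ≤ R * ∑ i ∈ t, w i := by
  rcases le_or_gt #s g with hsg | hsg
  · exact ⟨s, subset_rfl, hsg, mul_le_mul_of_nonneg_right hcR (sum_nonneg fun i _ => hw i)⟩
  obtain ⟨t, hts, htg, hle⟩ := exists_subset_nsmul_sum_le w s hsg.le
  refine ⟨t, hts, htg.le, ?_⟩
  rw [nsmul_eq_mul, nsmul_eq_mul] at hle
  have hg' : (0 : ℝ) < g := Nat.cast_pos.2 hg
  refine le_of_mul_le_mul_left ?_ hg'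
  calc g * (c * ∑ i ∈ s, w i) = c * (g * ∑ i ∈ s, w i) := by ring
    _ ≤ c * (#s * ∑ i ∈ t, w i) := mul_le_mul_of_nonneg_left hle hc
    _ = (c * #s) * ∑ i ∈ t, w i := by ring
    _ ≤ (g * R) * ∑ i ∈ t, w i := mul_le_mul_of_nonneg_right hs (sum_nonneg fun i _ => hw i)
    _ = g * (R * ∑ i ∈ t, w i) := by ring

end Averaging

section Replacement

variable {V : Type*} [DecidableEq V] {r m : ℕ} {E F : Finset (Finset V)} {x : V → ℝ}

lemma sized_memberSubfamily (hE : (E : Set (Finset V)).Sized (r + 1)) (a : V) :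
    (E.memberSubfamily a : Set (Finset V)).Sized r := by
  intro s hs
  obtain ⟨hmem, ha⟩ := mem_memberSubfamily.1 (mem_coe.1 hs)
  have hcard := hE hmem
  rw [card_insert_of_notMem ha] at hcard
  omega

lemma card_memberSubfamily (E : Finset (Finset V)) (a : V) :
    #(E.memberSubfamily a) = #{e ∈ E | a ∈ e} := by
  have hsplit := card_memberSubfamily_add_card_nonMemberSubfamily a E
  have hfilter := card_filter_add_card_filter_not (s := E) (a ∈ ·)
  rw [nonMemberSubfamily] at hsplit
  omega

omit [DecidableEq V] in
lemma pow_mul_card_le_weight (hE : (E : Set (Finset V)).Sized r) {c : ℝ} (hc : 0 ≤ c)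
    (h : ∀ e ∈ E, ∀ i ∈ e, c ≤ x i) : #E * c ^ r ≤ weight E x := by
  rw [← nsmul_eq_mul]
  refine card_nsmul_le_sum E _ _ fun e he => ?_
  rw [← hE he, ← prod_const]
  exact prod_le_prod (fun _ _ => hc) (h e he)

variable [Fintype V]

/-- The `r`-sets avoiding `v` that are not edges. -/
def missing (r : ℕ) (E : Finset (Finset V)) (v : V) : Finset (Finset V) :=
  (univ.erase v).powersetCard r \ E

lemma mem_missing {v : V} {f : Finset V} : f ∈ missing r E v ↔ #f = r ∧ v ∉ f ∧ f ∉ E := by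
  simp only [missing, mem_sdiff, mem_powersetCard, subset_erase, subset_univ, true_and]
  tauto

lemma sized_missing (E : Finset (Finset V)) (v : V) :
    (missing r E v : Set (Finset V)).Sized r := fun _ hf => (mem_missing.1 (mem_coe.1 hf)).1

lemma card_memberSubfamily_lt_card_missing (hE : #E < (Fintype.card V - 1).choose r) (v : V) :
    #(E.memberSubfamily v) < #(missing r E v) := by
  have hsdiff : missing r E v = (univ.erase v).powersetCard r \ E.nonMemberSubfamily v := by
    ext f
    simp only [missing, mem_sdiff, mem_powersetCard, mem_nonMemberSubfamily, subset_erase]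
    tauto
  have hle := le_card_sdiff (E.nonMemberSubfamily v) ((univ.erase v).powersetCard r)
  rw [← hsdiff, card_powersetCard, card_erase_of_mem (mem_univ v), card_univ] at hle
  have hsplit := card_memberSubfamily_add_card_nonMemberSubfamily v E
  omega

/-- Moving the whole weight of `b` to `a` makes the edges at `b` worthless, so that the same number
of sets `F` may replace them. -/
lemma IsExtremal.weight_add_mul_le (h : IsExtremal r m E x) {a b : V} (hab : a ≠ b) (ha : 0 < x a)
    (hb : 0 < x b) (hF : F ⊆ missing r E b) (hcard : #F ≤ #(E.memberSubfamily b)) :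
    weight F x + x b * weight (F.memberSubfamily a) x ≤ x b ^ 2 * pairWeight E x a b := by
  set y := transfer x a b (x b) with hy
  have hbF : F.memberSubfamily b = ∅ := eq_empty_of_forall_notMem fun s hs =>
    (mem_missing.1 (hF (mem_memberSubfamily.1 hs).1)).2.1 (mem_insert_self b s)
  have hFy : weight F y = weight F x + x b * weight (F.memberSubfamily a) x := by
    rw [hy, weight_transfer hab, pairWeight, memberSubfamily_comm, hbF]
    simp [weight, memberSubfamily]
  have hEy : weight (E.nonMemberSubfamily b) y = weight E y := by
    rw [weight_eq_nonMember_add_member E y b, hy, transfer_right hab]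
    ring
  have hdisj : Disjoint (E.nonMemberSubfamily b) F := disjoint_left.2 fun e he hf =>
    (mem_missing.1 (hF hf)).2.2 (mem_nonMemberSubfamily.1 he).1
  have hsized : ((E.nonMemberSubfamily b ∪ F : Finset (Finset V)) : Set (Finset V)).Sized r := by
    rw [coe_union]
    exact Set.sized_union.2 ⟨h.sized.mono fun e he => (mem_nonMemberSubfamily.1 he).1,
      (sized_missing E b).mono (coe_subset.2 hF)⟩
  have hle : #(E.nonMemberSubfamily b ∪ F) ≤ m := by
    have hsplit := card_memberSubfamily_add_card_nonMemberSubfamily b E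
    have hm := h.card_le
    rw [card_union_of_disjoint hdisj]
    omega
  have hmax := h.weight_le _ hsized hle y
    (transfer_mem_stdSimplex hab h.mem_stdSimplex (by linarith) le_rfl)
  rw [weight_union hdisj, hEy, hFy, hy, h.weight_transfer_eq hab ha hb] at hmax
  linarith

end Replacement

section PairLink

variable {V : Type*} [DecidableEq V] [Fintype V] {E : Finset (Finset V)} {x : V → ℝ} {a b w : V}

/-- The vertices completing `a, b` to an edge of a family of triples. -/
def pairLink (E : Finset (Finset V)) (a b : V) : Finset V :=
  {w | {w} ∈ (E.memberSubfamily a).memberSubfamily b}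

lemma mem_pairLink : w ∈ pairLink E a b ↔ {a, b, w} ∈ E ∧ a ≠ b ∧ a ≠ w ∧ b ≠ w := by
  simp only [pairLink, mem_filter, mem_univ, true_and, mem_memberSubfamily, mem_insert,
    mem_singleton, not_or]
  tauto

lemma mem_pairLink_rotate : w ∈ pairLink E a b ↔ a ∈ pairLink E b w := by
  have hset : ({a, b, w} : Finset V) = {b, w, a} := by
    rw [insert_comm a, pair_comm a]
  rw [mem_pairLink, mem_pairLink, hset]
  tauto

lemma pairLink_subset_compl (E : Finset (Finset V)) (a b : V) : pairLink E a b ⊆ {a, b}ᶜ := by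
  intro w hw
  obtain ⟨-, -, haw, hbw⟩ := mem_pairLink.1 hw
  simp [haw.symm, hbw.symm]

lemma memberSubfamily_memberSubfamily_eq_powersetCard (hE : (E : Set (Finset V)).Sized 3)
    (a b : V) : (E.memberSubfamily a).memberSubfamily b = (pairLink E a b).powersetCard 1 := by
  ext s
  have hsized := sized_memberSubfamily (sized_memberSubfamily hE a) b
  simp only [mem_powersetCard, card_eq_one]
  constructor
  · intro hs
    obtain ⟨w, rfl⟩ := card_eq_one.1 (hsized hs)
    exact ⟨by simpa [pairLink] using hs, w, rfl⟩
  · rintro ⟨hs, w, rfl⟩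
    simpa [pairLink] using hs

lemma weight_powersetCard_one {V : Type*} (S : Finset V) (x : V → ℝ) :
    weight (S.powersetCard 1) x = ∑ i ∈ S, x i := by
  simp [weight, powersetCard_one]

lemma pairWeight_eq_sum (hE : (E : Set (Finset V)).Sized 3) (x : V → ℝ) (a b : V) :
    pairWeight E x a b = ∑ w ∈ pairLink E a b, x w := by
  rw [pairWeight, memberSubfamily_memberSubfamily_eq_powersetCard hE, weight_powersetCard_one]

lemma card_filter_link_eq_card_pairLink (hE : (E : Set (Finset V)).Sized 3) (a b : V) :
    #{s ∈ E.memberSubfamily a | b ∈ s} = #(pairLink E a b) := by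
  rw [← card_memberSubfamily, memberSubfamily_memberSubfamily_eq_powersetCard hE,
    card_powersetCard, Nat.choose_one_right]

end PairLink

section Excess

variable {V : Type*} [DecidableEq V] [Fintype V] {E : Finset (Finset V)} {x : V → ℝ}

lemma weight_excess_le (hE : (E : Set (Finset V)).Sized 3) (hx : ∀ i, 0 ≤ x i) (a : V) {b c : V}
    (hbc : b ≠ c) :
    weight (excess E a b) x ≤ weight ((missing 3 E c).memberSubfamily b) x
      + x c * ∑ p ∈ (insert b (insert c (pairLink E b c)))ᶜ, x p := by
  have hcard : ∀ s ∈ excess E a b, #s = 2 := fun s hs => by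
    obtain ⟨has, -, hins, -⟩ := mem_excess.1 hs
    have := hE hins
    rw [card_insert_of_notMem has] at this
    omega
  rw [weight_eq_nonMember_add_member _ x c, ← weight_powersetCard_one]
  refine add_le_add (weight_mono (fun s hs => ?_) hx)
    (mul_le_mul_of_nonneg_left (weight_mono (fun s hs => ?_) hx) (hx c))
  · obtain ⟨hs, hcs⟩ := mem_nonMemberSubfamily.1 hs
    obtain ⟨-, hbs, -, hins⟩ := mem_excess.1 hs
    refine mem_memberSubfamily.2 ⟨mem_missing.2 ⟨?_, ?_, hins⟩, hbs⟩
    · rw [card_insert_of_notMem hbs, hcard s hs]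
    · simp [hbc.symm, hcs]
  · obtain ⟨hs, hcs⟩ := mem_memberSubfamily.1 hs
    obtain ⟨-, hbs, -, hins⟩ := mem_excess.1 hs
    have hs1 := hcard _ hs
    rw [card_insert_of_notMem hcs] at hs1
    obtain ⟨p, rfl⟩ := card_eq_one.1 (Nat.succ_injective hs1)
    simp only [mem_insert, mem_singleton, not_or] at hbs hcs
    simpa [mem_pairLink, Ne.symm hbs.2, Ne.symm hcs] using fun hp => absurd hp hins

lemma card_memberSubfamily_missing_le (r : ℕ) (E : Finset (Finset V)) {a b : V} (hab : a ≠ b) :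
    #((missing (r + 1) E b).memberSubfamily a) ≤ (Fintype.card V - 2).choose r := by
  have hsub : (missing (r + 1) E b).memberSubfamily a ⊆ ({a, b}ᶜ : Finset V).powersetCard r := by
    intro s hs
    obtain ⟨hmem, has⟩ := mem_memberSubfamily.1 hs
    have hbs : b ∉ s := fun hb => (mem_missing.1 hmem).2.1 (mem_insert_of_mem hb)
    refine mem_powersetCard.2
      ⟨fun i hi => ?_, sized_memberSubfamily (sized_missing E b) a (mem_coe.2 hs)⟩
    simp [ne_of_mem_of_not_mem hi has, ne_of_mem_of_not_mem hi hbs]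
  simpa only [card_powersetCard, card_compl, card_pair hab] using card_le_card hsub

lemma IsExtremal.card_mul_pow_add_mul_le {r m : ℕ} (h : IsExtremal r m E x) {a b : V}
    (hab : a ≠ b) (ha : 0 < x a) (hb : 0 < x b) (hlt : #E < (Fintype.card V - 1).choose r) {c : ℝ}
    (hc : 0 ≤ c) (hcx : ∀ i, i ≠ b → c ≤ x i) {T : Finset (Finset V)}
    (hT : T ⊆ (missing r E b).memberSubfamily a) (hTcard : #T ≤ #(E.memberSubfamily b)) :
    #(E.memberSubfamily b) * c ^ r + x b * weight T x ≤ x b ^ 2 * pairWeight E x a b := by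
  have hTa : ∀ s ∈ T, a ∉ s := fun s hs => (mem_memberSubfamily.1 (hT hs)).2
  have hinsert : T.image (insert a) ⊆ missing r E b := by
    rw [image_subset_iff]
    exact fun s hs => (mem_memberSubfamily.1 (hT hs)).1
  obtain ⟨F, hTF, hF, hFcard⟩ := exists_subsuperset_card_eq hinsert
    (card_image_le.trans hTcard) (card_memberSubfamily_lt_card_missing hlt b).le
  have hTmem : T ⊆ F.memberSubfamily a := fun s hs =>
    mem_memberSubfamily.2 ⟨hTF (mem_image_of_mem _ hs), hTa s hs⟩
  have hpow : #F * c ^ r ≤ weight F x :=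
    pow_mul_card_le_weight ((sized_missing E b).mono (coe_subset.2 hF)) hc fun e he i hi =>
      hcx i (ne_of_mem_of_not_mem hi (mem_missing.1 (hF he)).2.1)
  rw [← hFcard]
  exact (add_le_add hpow
    (mul_le_mul_of_nonneg_left (weight_mono hTmem h.nonneg) hb.le)).trans
    (h.weight_add_mul_le hab ha hb hF hFcard.le)

end Excess

section Density

variable {V : Type*} [LinearOrder V] {E : Finset (Finset V)} {x : V → ℝ}

section PairLink

variable [Fintype V] {a b w q : V}

lemma Shifted.mem_pairLink_of_le (hS : Shifted E) (hw : w ∈ pairLink E a b) (hqw : q ≤ w)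
    (hqa : q ≠ a) (hqb : q ≠ b) : q ∈ pairLink E a b := by
  rcases hqw.eq_or_lt with rfl | hqw
  · exact hw
  have hrotate (p : V) : ({a, b, p} : Finset V) = insert p {a, b} := by
    rw [pair_comm b, insert_comm]
  rw [mem_pairLink, hrotate] at hw ⊢
  obtain ⟨hmem, hab, haw, hbw⟩ := hw
  exact ⟨hS hqw (by simp [hqa, hqb]) (by simp [haw.symm, hbw.symm]) hmem, hab, hqa.symm, hqb.symm⟩

lemma Shifted.pairLink_eq_compl (hS : Shifted E) (hw : w ∈ pairLink E a b)
    (hmax : ∀ q, q ≠ a → q ≠ b → q ≤ w) : pairLink E a b = {a, b}ᶜ := by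
  refine (pairLink_subset_compl E a b).antisymm fun q hq => ?_
  simp only [mem_compl, mem_insert, mem_singleton, not_or] at hq
  exact hS.mem_pairLink_of_le hw (hmax q hq.1 hq.2) hq.1 hq.2

variable [BoundedOrder V] {u : V}

lemma Shifted.pairLink_top_eq_compl (hS : Shifted E) (hu : u ⋖ ⊤) (hw : w ∈ pairLink E u ⊤) :
    pairLink E ⊤ w = {⊤, w}ᶜ :=
  hS.pairLink_eq_compl (mem_pairLink_rotate.1 hw) fun _ hq _ =>
    hu.le_of_lt (lt_top_iff_ne_top.2 hq)

lemma Shifted.pairLink_bot_eq_compl (hS : Shifted E) (hbot : ⊥ ∈ pairLink E u ⊤) :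
    pairLink E ⊥ u = {⊥, u}ᶜ :=
  hS.pairLink_eq_compl (mem_pairLink_rotate.2 hbot) fun _ _ _ => le_top

lemma Shifted.card_pairLink_mul_le (hS : Shifted E) (hE : (E : Set (Finset V)).Sized 3)
    (hu : u ⋖ ⊤) :
    #(pairLink E u ⊤) * (Fintype.card V - 2) ≤ #(E.memberSubfamily ⊤) * 2 := by
  refine (le_sum_card_inter (B := E.memberSubfamily ⊤) fun w hw => ?_).trans
    (sum_le_card_nsmul _ _ _ fun s hs =>
      (card_le_card inter_subset_right).trans (sized_memberSubfamily hE ⊤ hs).le)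
  obtain ⟨-, -, -, hw_top⟩ := mem_pairLink.1 hw
  rw [card_filter_link_eq_card_pairLink hE, hS.pairLink_top_eq_compl hu hw, card_compl,
    card_pair hw_top]

end PairLink

/-- The inequality behind `choose_le_card`. There `b` is the number of edges through `u` and `⊤`,
`g` the degree of `⊤`, and `o`, `u`, `v` are the weights of `⊥`, `u`, `⊤`; `P` is the weight of the
pairs completing `u` to a missing triple and `T` that of at most `g` of these pairs; `Q` is the
weight of the other vertices outside `pairLink E u ⊤`, `R` that of all vertices except `⊥` and `u`,
and `S` is `pairWeight E x u ⊤`. -/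
lemma sq_mul_lt_of_sub_mul_le {b g o u v P T Q R S : ℝ} (hb : 0 < b) (hv : 0 < v) (hvu : v ≤ u)
    (hR : 0 < R) (hdiff : (o - u) * R ≤ P + v * Q) (hQ : b * v + Q ≤ R) (hT : b * v * P ≤ R * T)
    (hS : S ≤ b * o) (hg : 2 * b ≤ g) : v ^ 2 * S < g * u ^ 3 + v * T := by
  have hbv : 0 < b * v := mul_pos hb hv
  have hu2 : v ^ 2 * u ≤ u ^ 3 := by
    have := pow_le_pow_left₀ hv.le hvu 2
    nlinarith
  have hu3 : v ^ 3 ≤ u ^ 3 := pow_le_pow_left₀ hv.le hvu 3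
  refine lt_of_mul_lt_mul_right ?_ hR.le
  calc v ^ 2 * S * R ≤ v ^ 2 * (b * o) * R := by gcongr
    _ = b * v ^ 2 * ((o - u) * R) + b * (v ^ 2 * u) * R := by ring
    _ ≤ b * v ^ 2 * (P + v * Q) + b * u ^ 3 * R := by gcongr
    _ = v * (b * v * P) + b * v ^ 3 * Q + b * u ^ 3 * R := by ring
    _ < v * (R * T) + b * v ^ 3 * R + b * u ^ 3 * R := by
      have : b * v ^ 3 * Q < b * v ^ 3 * R := mul_lt_mul_of_pos_left (by linarith) (by positivity)
      linarith [mul_le_mul_of_nonneg_left hT hv.le]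
    _ ≤ v * (R * T) + b * u ^ 3 * R + b * u ^ 3 * R := by gcongr
    _ = (2 * b * u ^ 3 + v * T) * R := by ring
    _ ≤ (g * u ^ 3 + v * T) * R := by
      have : 0 < u := hv.trans_le hvu
      gcongr

namespace IsCompressedExtremal

variable [Fintype V] [BoundedOrder V] {m : ℕ} {u : V}

lemma le_of_ne_top {r : ℕ} (h : IsCompressedExtremal r m E x) (hu : u ⋖ ⊤) {i : V} (hi : i ≠ ⊤) :
    x u ≤ x i :=
  h.antitone (hu.le_of_lt (lt_top_iff_ne_top.2 hi))

lemma pairWeight_le (h : IsCompressedExtremal 3 m E x) (a b : V) :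
    pairWeight E x a b ≤ #(pairLink E a b) * x ⊥ := by
  rw [pairWeight_eq_sum h.sized, ← nsmul_eq_mul]
  exact sum_le_card_nsmul _ _ _ fun i _ => h.antitone bot_le

lemma card_pairLink_mul_add_sum_le (h : IsCompressedExtremal 3 m E x) (hbot : ⊥ ∈ pairLink E u ⊤) :
    #(pairLink E u ⊤) * x ⊤ + ∑ p ∈ (insert u (insert ⊤ (pairLink E u ⊤)))ᶜ, x p
      ≤ ∑ p ∈ {⊥, u}ᶜ, x p := by
  have hsub : (insert u (insert ⊤ (pairLink E u ⊤)))ᶜ ⊆ ({⊥, u} : Finset V)ᶜ :=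
    compl_subset_compl.2 (by simp [insert_subset_iff, hbot])
  have htop : ⊤ ∉ pairLink E u ⊤ := fun hmem => (mem_pairLink.1 hmem).2.2.2 rfl
  have hu_notMem : u ∉ insert ⊤ (pairLink E u ⊤) := by
    simpa [(mem_pairLink.1 hbot).2.1] using fun hmem => (mem_pairLink.1 hmem).2.2.1 rfl
  have hcard : #(({⊥, u} : Finset V)ᶜ \ (insert u (insert ⊤ (pairLink E u ⊤)))ᶜ)
      = #(pairLink E u ⊤) := by
    have hle := card_le_univ (insert u (insert ⊤ (pairLink E u ⊤)))
    rw [card_insert_of_notMem hu_notMem, card_insert_of_notMem htop] at hle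
    rw [card_sdiff_of_subset hsub, card_compl, card_compl, card_insert_of_notMem hu_notMem,
      card_insert_of_notMem htop, card_pair (mem_pairLink.1 hbot).2.2.1.symm]
    omega
  rw [← sum_sdiff hsub, ← hcard, ← nsmul_eq_mul]
  exact add_le_add_left (card_nsmul_le_sum _ _ _ fun i _ => h.antitone le_top) _

lemma bot_sub_mul_le (h : IsCompressedExtremal 3 m E x) (hbot : ⊥ ∈ pairLink E u ⊤) :
    (x ⊥ - x u) * ∑ p ∈ {⊥, u}ᶜ, x p ≤ weight ((missing 3 E ⊤).memberSubfamily u) x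
      + x ⊤ * ∑ p ∈ (insert u (insert ⊤ (pairLink E u ⊤)))ᶜ, x p := by
  rw [← h.shifted.pairLink_bot_eq_compl hbot, ← pairWeight_eq_sum h.sized,
    h.sub_mul_pairWeight (mem_pairLink.1 hbot).2.2.1.symm (h.pos _) (h.pos _)]
  exact (sub_le_self _ (weight_nonneg h.nonneg)).trans
    (weight_excess_le h.sized h.nonneg ⊥ (mem_pairLink.1 hbot).2.1)

lemma card_pairLink_mul_card_missing_le (h : IsCompressedExtremal 3 m E x) (hu : u ⋖ ⊤) :
    #(pairLink E u ⊤) * #((missing 3 E ⊤).memberSubfamily u)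
      ≤ #(E.memberSubfamily ⊤) * (Fintype.card V - 2) := by
  have hmissing := card_memberSubfamily_missing_le 2 E hu.ne
  rw [Nat.choose_two_right, Nat.le_div_iff_mul_le two_pos] at hmissing
  refine le_of_mul_le_mul_right ?_ two_pos
  calc #(pairLink E u ⊤) * #((missing 3 E ⊤).memberSubfamily u) * 2
      ≤ #(pairLink E u ⊤) * ((Fintype.card V - 2) * (Fintype.card V - 2 - 1)) := by
        rw [mul_assoc]
        exact Nat.mul_le_mul_left _ hmissing
    _ = #(pairLink E u ⊤) * (Fintype.card V - 2) * (Fintype.card V - 2 - 1) :=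
        (mul_assoc _ _ _).symm
    _ ≤ #(E.memberSubfamily ⊤) * 2 * (Fintype.card V - 2) :=
        Nat.mul_le_mul (h.shifted.card_pairLink_mul_le h.sized hu) (Nat.sub_le _ _)
    _ = #(E.memberSubfamily ⊤) * (Fintype.card V - 2) * 2 := mul_right_comm _ _ _

lemma exists_subset_missing (h : IsCompressedExtremal 3 m E x) (hu : u ⋖ ⊤)
    (hbot : ⊥ ∈ pairLink E u ⊤) :
    ∃ T ⊆ (missing 3 E ⊤).memberSubfamily u, #T ≤ #(E.memberSubfamily ⊤) ∧
      #(pairLink E u ⊤) * x ⊤ * weight ((missing 3 E ⊤).memberSubfamily u) x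
        ≤ (∑ p ∈ {⊥, u}ᶜ, x p) * weight T x := by
  have hdegree : 0 < #(E.memberSubfamily ⊤) :=
    card_pos.2 ⟨_, (mem_memberSubfamily.1 (mem_filter.1 (mem_pairLink_rotate.1 hbot)).2).1⟩
  have hR : (Fintype.card V - 2 : ℕ) * x ⊤ ≤ ∑ p ∈ {⊥, u}ᶜ, x p := by
    have hbu : ⊥ ≠ u := (mem_pairLink.1 hbot).2.2.1.symm
    rw [← card_pair hbu, ← card_compl, ← nsmul_eq_mul]
    exact card_nsmul_le_sum _ _ _ fun i _ => h.antitone le_top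
  refine exists_subset_card_le_mul_sum_le (fun s => prod_nonneg fun i _ => h.nonneg i) hdegree
    (mul_nonneg (Nat.cast_nonneg _) (h.nonneg ⊤)) ?_ ?_
  · exact (le_add_of_nonneg_right (sum_nonneg fun _ _ => h.nonneg _)).trans
      (h.card_pairLink_mul_add_sum_le hbot)
  · calc (#(pairLink E u ⊤) : ℝ) * x ⊤ * #((missing 3 E ⊤).memberSubfamily u)
        = (#(pairLink E u ⊤) * #((missing 3 E ⊤).memberSubfamily u) : ℕ) * x ⊤ := by
          push_cast
          ring
      _ ≤ (#(E.memberSubfamily ⊤) * (Fintype.card V - 2) : ℕ) * x ⊤ :=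
          mul_le_mul_of_nonneg_right
            (Nat.cast_le.2 (h.card_pairLink_mul_card_missing_le hu)) (h.nonneg ⊤)
      _ = #(E.memberSubfamily ⊤) * ((Fintype.card V - 2 : ℕ) * x ⊤) := by
          push_cast
          ring
      _ ≤ _ := mul_le_mul_of_nonneg_left hR (Nat.cast_nonneg _)

theorem choose_le_card (h : IsCompressedExtremal 3 m E x) (hcard : 6 ≤ Fintype.card V)
    (hu : u ⋖ ⊤) (hbot : ⊥ ∈ pairLink E u ⊤) : (Fintype.card V - 1).choose 3 ≤ #E := by
  by_contra! hlt
  obtain ⟨T, hT, hTcard, hTle⟩ := h.exists_subset_missing hu hbot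
  have hgain := h.card_mul_pow_add_mul_le hu.ne (h.pos u) (h.pos ⊤) hlt (h.pos u).le
    (fun _ hi => h.le_of_ne_top hu hi) hT hTcard
  have hlink : (0 : ℝ) < #(pairLink E u ⊤) := Nat.cast_pos.2 (card_pos.2 ⟨⊥, hbot⟩)
  have hle := h.card_pairLink_mul_add_sum_le hbot
  have hdegree : 2 * #(pairLink E u ⊤) ≤ #(E.memberSubfamily ⊤) := by
    have hmul := h.shifted.card_pairLink_mul_le h.sized hu
    have := Nat.mul_le_mul_left #(pairLink E u ⊤) (show 4 ≤ Fintype.card V - 2 by omega)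
    omega
  have hR : 0 < ∑ p ∈ {⊥, u}ᶜ, x p :=
    (add_pos_of_pos_of_nonneg (mul_pos hlink (h.pos ⊤))
      (sum_nonneg fun _ _ => h.nonneg _)).trans_le hle
  exact hgain.not_gt (sq_mul_lt_of_sub_mul_le hlink (h.pos ⊤) (h.antitone le_top) hR
    (h.bot_sub_mul_le hbot) hle hTle (h.pairWeight_le u ⊤) (mod_cast hdegree))

end IsCompressedExtremal

end Density

section Missing

variable {V : Type*} [DecidableEq V] [Fintype V] {r : ℕ} {E : Finset (Finset V)} {a b : V}

lemma excess_eq_empty_of_missing_eq_empty (hE : (E : Set (Finset V)).Sized r)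
    (hmissing : missing r E b = ∅) (a : V) : excess E b a = ∅ := by
  refine eq_empty_of_forall_notMem fun s hs => ?_
  obtain ⟨hbs, has, hins, hnot⟩ := mem_excess.1 hs
  have hba : b ≠ a := by
    rintro rfl
    exact hnot hins
  have hcard : #(insert a s) = r := by
    rw [card_insert_of_notMem has, ← card_insert_of_notMem hbs, hE hins]
  exact notMem_empty _ (hmissing ▸ mem_missing.2 ⟨hcard, by simp [hba, hbs], hnot⟩)

lemma card_memberSubfamily_memberSubfamily_le_card_excess (hab : a ≠ b)
    (hmissing : missing (r + 1) E b = ∅)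
    (hE : #E ≤ (Fintype.card V - 1).choose (r + 1) + (Fintype.card V - 2).choose r) :
    #((E.memberSubfamily a).memberSubfamily b) ≤ #(excess E a b) := by
  have hmem {s : Finset V} (hs : #s = r + 1) (hb : b ∉ s) : s ∈ E := by
    by_contra hsE
    exact notMem_empty s (hmissing ▸ mem_missing.2 ⟨hs, hb, hsE⟩)
  have hnonMember : (Fintype.card V - 1).choose (r + 1) ≤ #(E.nonMemberSubfamily b) := by
    rw [← card_univ, ← card_erase_of_mem (mem_univ b), ← card_powersetCard]
    refine card_le_card fun s hs => ?_
    rw [mem_powersetCard, subset_erase] at hs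
    exact mem_nonMemberSubfamily.2 ⟨hmem hs.2 hs.1.2, hs.1.2⟩
  have hlink : (Fintype.card V - 2).choose r
      ≤ #(excess E a b) + #((E.memberSubfamily b).nonMemberSubfamily a) := by
    rw [← card_pair hab, ← card_compl, ← card_powersetCard]
    refine (card_le_card fun s hs => ?_).trans (card_union_le _ _)
    obtain ⟨hsub, hs⟩ := mem_powersetCard.1 hs
    have has : a ∉ s := fun ha => by simpa using hsub ha
    have hbs : b ∉ s := fun hb => by simpa using hsub hb
    have hins : insert a s ∈ E :=
      hmem (by rw [card_insert_of_notMem has, hs]) (by simp [hab.symm, hbs])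
    rw [mem_union, mem_excess, mem_nonMemberSubfamily, mem_memberSubfamily]
    tauto
  have hE' := card_memberSubfamily_add_card_nonMemberSubfamily b E
  have hEb := card_memberSubfamily_add_card_nonMemberSubfamily a (E.memberSubfamily b)
  rw [memberSubfamily_comm]
  omega

end Missing

namespace IsCompressedExtremal

variable {V : Type*} [LinearOrder V] [Fintype V] [BoundedOrder V] {m : ℕ} {E : Finset (Finset V)}
  {x : V → ℝ} {u : V}

lemma bot_lt_add_top (h : IsCompressedExtremal 3 m E x) (hmissing : missing 3 E ⊤ = ∅)
    (hu : u ⋖ ⊤) (hbot : ⊥ ∈ pairLink E u ⊤) {p : V} (hp : p ≠ ⊤) : x ⊥ < x p + x ⊤ := by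
  rcases eq_or_ne p ⊥ with rfl | hp_bot
  · exact lt_add_of_pos_right _ (h.pos ⊤)
  have hbotp : ⊥ ∈ pairLink E p ⊤ := mem_pairLink_rotate.2 <|
    h.shifted.mem_pairLink_of_le (mem_pairLink_rotate.1 hbot)
      (hu.le_of_lt (lt_top_iff_ne_top.2 hp)) hp hp_bot
  set R := ∑ q ∈ {⊥, p}ᶜ, x q
  set Q := ∑ q ∈ (insert p (insert ⊤ (pairLink E p ⊤)))ᶜ, x q
  have hdiff : (x ⊥ - x p) * R ≤ x ⊤ * Q := by
    have hempty : weight ((missing 3 E ⊤).memberSubfamily p) x = 0 := by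
      simp [hmissing, weight, memberSubfamily]
    simpa only [hempty, zero_add] using h.bot_sub_mul_le hbotp
  have hlink : (1 : ℝ) ≤ #(pairLink E p ⊤) := Nat.one_le_cast.2 (card_pos.2 ⟨⊥, hbotp⟩)
  have hQR : Q < R := by
    have := h.card_pairLink_mul_add_sum_le hbotp
    linarith [mul_le_mul_of_nonneg_right hlink (h.nonneg ⊤), h.pos ⊤]
  have hR : 0 < R := (sum_nonneg fun _ _ => h.nonneg _).trans_lt hQR
  have := lt_of_mul_lt_mul_right (hdiff.trans_lt (mul_lt_mul_of_pos_left hQR (h.pos ⊤))) hR.le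
  linarith

lemma mul_bot_lt_prod_of_mem_excess (h : IsCompressedExtremal 3 m E x)
    (hmissing : missing 3 E ⊤ = ∅) (hu : u ⋖ ⊤) (hbot : ⊥ ∈ pairLink E u ⊤) {s : Finset V}
    (hs : s ∈ excess E u ⊤) : (x u - x ⊤) * x ⊥ < ∏ i ∈ s, x i := by
  obtain ⟨hus, htop, hins, -⟩ := mem_excess.1 hs
  have hcard := h.sized hins
  rw [card_insert_of_notMem hus] at hcard
  obtain ⟨p, q, hpq, rfl⟩ := card_eq_two.1 (Nat.succ_injective hcard)
  simp only [mem_insert, mem_singleton, not_or] at htop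
  rw [prod_pair hpq]
  calc (x u - x ⊤) * x ⊥ ≤ (x ⊥ - x ⊤) * x u := by
        linarith [mul_le_mul_of_nonneg_left (h.antitone (bot_le (a := u))) (h.nonneg ⊤)]
    _ < x p * x u := mul_lt_mul_of_pos_right
        (sub_lt_iff_lt_add.2 (h.bot_lt_add_top hmissing hu hbot (Ne.symm htop.1))) (h.pos u)
    _ ≤ x p * x q := mul_le_mul_of_nonneg_left (h.le_of_ne_top hu (Ne.symm htop.2)) (h.nonneg p)

theorem choose_add_choose_lt_card (h : IsCompressedExtremal 3 m E x) (hu : u ⋖ ⊤)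
    (hbot : ⊥ ∈ pairLink E u ⊤) (hmissing : missing 3 E ⊤ = ∅) :
    (Fintype.card V - 1).choose 3 + (Fintype.card V - 2).choose 2 < #E := by
  by_contra! hE
  have hlink : #(pairLink E u ⊤) ≤ #(excess E u ⊤) := by
    have := card_memberSubfamily_memberSubfamily_le_card_excess hu.ne hmissing hE
    rwa [memberSubfamily_memberSubfamily_eq_powersetCard h.sized, card_powersetCard,
      Nat.choose_one_right] at this
  have hnonempty : (excess E u ⊤).Nonempty :=
    card_pos.1 ((card_pos.2 ⟨⊥, hbot⟩).trans_le hlink)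
  have hsub : 0 ≤ x u - x ⊤ := sub_nonneg.2 (h.antitone le_top)
  have hbalance := h.sub_mul_pairWeight hu.ne (h.pos u) (h.pos ⊤)
  rw [excess_eq_empty_of_missing_eq_empty h.sized hmissing, weight, weight, sum_empty,
    sub_zero] at hbalance
  refine lt_irrefl ((x u - x ⊤) * pairWeight E x u ⊤) ?_
  calc (x u - x ⊤) * pairWeight E x u ⊤ ≤ (x u - x ⊤) * (#(pairLink E u ⊤) * x ⊥) :=
        mul_le_mul_of_nonneg_left (h.pairWeight_le u ⊤) hsub
    _ = #(pairLink E u ⊤) * ((x u - x ⊤) * x ⊥) := by ring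
    _ ≤ #(excess E u ⊤) * ((x u - x ⊤) * x ⊥) :=
        mul_le_mul_of_nonneg_right (Nat.cast_le.2 hlink) (mul_nonneg hsub (h.nonneg ⊥))
    _ = ∑ _s ∈ excess E u ⊤, (x u - x ⊤) * x ⊥ := by rw [sum_const, nsmul_eq_mul]
    _ < ∑ s ∈ excess E u ⊤, ∏ i ∈ s, x i := sum_lt_sum_of_nonempty hnonempty fun s hs =>
        h.mul_bot_lt_prod_of_mem_excess hmissing hu hbot hs
    _ = (x u - x ⊤) * pairWeight E x u ⊤ := hbalance.symm

end IsCompressedExtremal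

/-! ### Relabelling the vertices -/

section Trace

variable {V W : Type*}

/-- The trace of a family of sets along an embedding: the sets whose image belongs to the family. -/
noncomputable def trace (ι : W ↪ V) (E : Finset (Finset V)) : Finset (Finset W) :=
  E.preimage (map ι) (map_injective ι).injOn

lemma mem_trace {ι : W ↪ V} {E : Finset (Finset V)} {f : Finset W} :
    f ∈ trace ι E ↔ f.map ι ∈ E := mem_preimage

lemma map_trace_subset (ι : W ↪ V) (E : Finset (Finset V)) :
    (trace ι E).map (mapEmbedding ι).toEmbedding ⊆ E :=
  map_subset_iff_subset_preimage.2 Subset.rfl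

lemma card_trace_le (ι : W ↪ V) (E : Finset (Finset V)) : #(trace ι E) ≤ #E :=
  (card_map _).ge.trans (card_le_card (map_trace_subset ι E))

lemma sized_trace {ι : W ↪ V} {r : ℕ} {E : Finset (Finset V)}
    (hE : (E : Set (Finset V)).Sized r) : (trace ι E : Set (Finset W)).Sized r :=
  fun _ hf => (card_map ι).symm.trans (hE (mem_trace.1 hf))

lemma sized_map (ι : W ↪ V) {r : ℕ} {E : Finset (Finset W)}
    (hE : (E : Set (Finset W)).Sized r) :
    (E.map (mapEmbedding ι).toEmbedding : Set (Finset V)).Sized r := by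
  intro e he
  obtain ⟨f, hf, rfl⟩ := mem_map.1 (mem_coe.1 he)
  exact (card_map ι).trans (hE hf)

lemma exists_map_eq {ι : W ↪ V} {e : Finset V} (h : ∀ i ∈ e, i ∈ Set.range ι) :
    ∃ f : Finset W, f.map ι = e := by
  classical
  obtain ⟨f, -, hf⟩ := subset_map_iff.1
    (fun i hi => by
      obtain ⟨w, rfl⟩ := h i hi
      exact mem_map_of_mem ι (mem_preimage.2 hi) :
      e ⊆ (e.preimage ι ι.injective.injOn).map ι)
  exact ⟨f, hf.symm⟩

lemma weight_map (ι : W ↪ V) (E : Finset (Finset W)) (x : V → ℝ) :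
    weight (E.map (mapEmbedding ι).toEmbedding) x = weight E (x ∘ ι) := by
  simp [weight, mapEmbedding_apply]

lemma weight_trace {ι : W ↪ V} {E : Finset (Finset V)} {x : V → ℝ}
    (h : ∀ e ∈ E, (∃ i ∈ e, i ∉ Set.range ι) → ∏ i ∈ e, x i = 0) :
    weight (trace ι E) (x ∘ ι) = weight E x := by
  rw [← weight_map]
  refine sum_subset (map_trace_subset ι E) fun e he hne => h e he ?_
  by_contra! hrange
  obtain ⟨f, rfl⟩ := exists_map_eq hrange
  exact hne (mem_map_of_mem _ (mem_trace.2 he))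

lemma weight_trace_of_eq_zero {ι : W ↪ V} {x : V → ℝ} (hx : ∀ i ∉ Set.range ι, x i = 0)
    (E : Finset (Finset V)) : weight (trace ι E) (x ∘ ι) = weight E x :=
  weight_trace fun _ _ ⟨_, hi, hrange⟩ => prod_eq_zero hi (hx _ hrange)

variable [Fintype V] [Fintype W]

lemma comp_mem_stdSimplex {ι : W ↪ V} {x : V → ℝ} (hx : x ∈ stdSimplex ℝ V)
    (hx0 : ∀ i ∉ Set.range ι, x i = 0) : x ∘ ι ∈ stdSimplex ℝ W :=
  ⟨fun w => hx.1 (ι w), (Fintype.sum_of_injective ι ι.injective _ _ hx0 fun _ => rfl).trans hx.2⟩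

lemma extend_mem_stdSimplex (ι : W ↪ V) {y : W → ℝ} (hy : y ∈ stdSimplex ℝ W) :
    Function.extend ι y (0 : V → ℝ) ∈ stdSimplex ℝ V := by
  refine ⟨fun i => ?_, (Fintype.sum_of_injective ι ι.injective _ _ (fun i hi => ?_)
    fun w => (ι.injective.extend_apply y 0 w).symm).symm.trans hy.2⟩
  · by_cases hi : ∃ w, ι w = i
    · obtain ⟨w, rfl⟩ := hi
      exact (hy.1 w).trans_eq (ι.injective.extend_apply y 0 w).symm
    · exact (Function.extend_apply' y (0 : V → ℝ) i hi).ge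
  · exact Function.extend_apply' y (0 : V → ℝ) i hi

lemma IsExtremal.comp {r m : ℕ} {E : Finset (Finset V)} {x : V → ℝ} (h : IsExtremal r m E x)
    {ι : W ↪ V} (hx : ∀ i ∉ Set.range ι, x i = 0) : IsExtremal r m (trace ι E) (x ∘ ι) where
  sized := sized_trace h.sized
  card_le := (card_trace_le ι E).trans h.card_le
  mem_stdSimplex := comp_mem_stdSimplex h.mem_stdSimplex hx
  weight_le F hF hm y hy := by
    have := h.weight_le _ (sized_map ι hF) ((card_map _).trans_le hm) _
      (extend_mem_stdSimplex ι hy)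
    rwa [weight_map, Function.extend_comp ι.injective, ← weight_trace_of_eq_zero hx] at this

omit [Fintype W] in
lemma exists_embedding_antitone (x : V → ℝ) {k : ℕ} (hk : #(positiveSupport x) = k) :
    ∃ ι : Fin k ↪ V, Antitone (x ∘ ι) ∧ Set.range ι = positiveSupport x := by
  let ε := (positiveSupport x).equivFinOfCardEq hk
  let σ := Tuple.sort fun w => -x (ε.symm w)
  refine ⟨(σ.trans ε.symm).toEmbedding.trans (.subtype _), fun a b hab =>
    neg_le_neg_iff.1 (Tuple.monotone_sort (fun w => -x (ε.symm w)) hab), ?_⟩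
  ext i
  refine ⟨?_, fun hi => ⟨(σ.trans ε.symm).symm ⟨i, hi⟩, ?_⟩⟩
  · rintro ⟨w, rfl⟩
    exact (ε.symm (σ w)).2
  · simp

end Trace

section Clique

variable {V W : Type*} {r n : ℕ}

/-- `E` contains all `r`-subsets of some `n`-set. -/
def ContainsClique (r n : ℕ) (E : Finset (Finset V)) : Prop :=
  ∃ T : Finset V, #T = n ∧ T.powersetCard r ⊆ E

lemma ContainsClique.of_map {ι : W ↪ V} {E : Finset (Finset W)} (hr : r ≠ 0) (hrn : r ≤ n)
    (h : ContainsClique r n (E.map (mapEmbedding ι).toEmbedding)) : ContainsClique r n E := by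
  obtain ⟨T, hT, hTE⟩ := h
  have hrange : ∀ i ∈ T, i ∈ Set.range ι := by
    intro i hi
    obtain ⟨e, hie, heT, he⟩ := exists_subsuperset_card_eq (singleton_subset_iff.2 hi)
      ((card_singleton i).trans_le (Nat.one_le_iff_ne_zero.2 hr)) (hrn.trans_eq hT.symm)
    obtain ⟨f, -, rfl⟩ := mem_map.1 (hTE (mem_powersetCard.2 ⟨heT, he⟩))
    obtain ⟨w, -, hw⟩ := mem_map.1 (singleton_subset_iff.1 hie)
    exact ⟨w, hw⟩
  obtain ⟨S, rfl⟩ := exists_map_eq hrange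
  rw [powersetCard_map, map_subset_map] at hTE
  exact ⟨S, (card_map ι).symm.trans hT, hTE⟩

lemma hasClique_of_containsClique {α : Type*} {G : RGraph r α}
    (h : ContainsClique r n (trace (.subtype (· ∈ G.verts)) G.edges)) : G.HasClique n := by
  obtain ⟨T, hT, hTE⟩ := h
  refine ⟨T.map (.subtype _), (card_map _).trans hT,
    fun i hi => property_of_mem_map_subtype T hi, ?_⟩
  change powersetCard r _ ⊆ _
  rw [powersetCard_map]
  exact (map_subset_map.2 hTE).trans (map_trace_subset _ _)

end Clique

section Shift

variable {V ι : Type*} [LinearOrder V] {E : Finset (Finset V)} {r : ℕ}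

lemma Shifted.image_update_mem [Fintype ι] [DecidableEq ι] (hS : Shifted E) {f : ι → V} {q : ι}
    {a : V} (hf : Function.Injective f) (hfa : Function.Injective (Function.update f q a))
    (ha : a ≤ f q) (h : univ.image f ∈ E) : univ.image (Function.update f q a) ∈ E := by
  rcases ha.eq_or_lt with rfl | hlt
  · rwa [Function.update_eq_self]
  have himage (g : ι → V) : univ.image g = insert (g q) ((univ.erase q).image g) := by
    rw [← image_insert, insert_erase (mem_univ q)]
  have hnotMem {g : ι → V} (hg : Function.Injective g) : g q ∉ (univ.erase q).image g :=
    fun hmem => notMem_erase q univ (hg.mem_finset_image.1 hmem)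
  have hcongr : (univ.erase q).image (Function.update f q a) = (univ.erase q).image f :=
    image_congr fun p hp => Function.update_of_ne (ne_of_mem_erase hp) a f
  have haq := hnotMem hfa
  rw [himage] at h ⊢
  rw [hcongr, Function.update_self] at haq ⊢
  exact hS hlt haq (hnotMem hf) h

lemma Shifted.image_mem (hS : Shifted E) {i j : Fin r → V} (hi : StrictMono i)
    (hj : StrictMono j) (hij : i ≤ j) (h : univ.image j ∈ E) : univ.image i ∈ E := by
  let hybrid (t : ℕ) (p : Fin r) : V := if p < t then i p else j p
  have hmono (t : ℕ) : StrictMono (hybrid t) := by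
    intro p q hpq
    simp only [hybrid]
    split_ifs with hp hq hq
    · exact hi hpq
    · exact (hi hpq).trans_le (hij q)
    · omega
    · exact hj hpq
  have hstep (q : Fin r) : hybrid (q + 1) = Function.update (hybrid q) q (i q) := by
    ext p
    by_cases hpq : p = q
    · simp [hpq, hybrid]
    · rw [Function.update_of_ne hpq]
      have : (p : ℕ) < q + 1 ↔ (p : ℕ) < q := by omega
      simp only [hybrid, this]
  have hmem : ∀ t ≤ r, univ.image (hybrid t) ∈ E := by
    intro t ht
    induction t with
    | zero => simpa [hybrid] using h
    | succ t ih =>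
      have hupdate := hstep ⟨t, ht⟩
      rw [hupdate]
      exact hS.image_update_mem (hmono t).injective (hupdate ▸ (hmono _).injective)
        (by simpa [hybrid] using hij _) (ih (Nat.le_of_succ_le ht))
  simpa [hybrid] using hmem r le_rfl

end Shift

section Graph

variable {V β : Type*} {r : ℕ}

lemma bddAbove_weightPoly {α : Type*} (G : RGraph r α) :
    BddAbove (G.weightPoly '' G.weightings) := by
  refine ⟨#G.edges, ?_⟩
  rintro _ ⟨y, hy, rfl⟩
  rw [RGraph.weightPoly, card_eq_sum_ones, Nat.cast_sum, Nat.cast_one]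
  refine sum_le_sum fun e he => ?_
  have hsub := (mem_powersetCard.1 (G.edges_sub he)).1
  exact prod_le_one (fun i hi => hy.1 i (hsub hi)) fun i hi =>
    hy.2 ▸ single_le_sum (fun j hj => hy.1 j hj) (hsub hi)

variable [Fintype V]

/-- The graph on the range of `ι` with the images of the members of `E` as edges. -/
def toGraph (ι : V ↪ β) (E : Finset (Finset V)) (hE : (E : Set (Finset V)).Sized r) :
    RGraph r β where
  verts := univ.map ι
  edges := E.map (mapEmbedding ι).toEmbedding
  edges_sub := by
    rw [powersetCard_map, map_subset_map]
    exact fun e he => mem_powersetCard_univ.2 (hE he)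

lemma map_mem_toGraph {ι : V ↪ β} {E : Finset (Finset V)} {hE : (E : Set (Finset V)).Sized r}
    {f : Finset V} : f.map ι ∈ (toGraph ι E hE).edges ↔ f ∈ E :=
  mem_map' (mapEmbedding ι).toEmbedding

lemma weight_le_lagrangian (ι : V ↪ β) {E : Finset (Finset V)}
    (hE : (E : Set (Finset V)).Sized r) {x : V → ℝ} (hx : x ∈ stdSimplex ℝ V) :
    weight E x ≤ (toGraph ι E hE).lagrangian := by
  refine le_csSup (bddAbove_weightPoly _) ⟨Function.extend ι x 0, ⟨?_, ?_⟩, ?_⟩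
  · simpa [toGraph, ι.injective.extend_apply] using hx.1
  · simpa [toGraph, ι.injective.extend_apply] using hx.2
  · exact (weight_map ι E _).trans (by rw [Function.extend_comp ι.injective])

lemma toGraph_leftCompressed [LinearOrder V] (ι : V ↪o ℕ) {E : Finset (Finset V)}
    (hE : (E : Set (Finset V)).Sized r) (hS : Shifted E) :
    (toGraph ι.toEmbedding E hE).LeftCompressed := by
  intro i j hi hj hiv hij hjE
  have hjv : ∀ p, j p ∈ univ.map ι.toEmbedding := fun p =>
    (mem_powersetCard.1 ((toGraph ι.toEmbedding E hE).edges_sub hjE)).1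
      (mem_image_of_mem j (mem_univ p))
  choose I _ hI using fun p => mem_map.1 (hiv p)
  choose J _ hJ using fun p => mem_map.1 (hjv p)
  obtain rfl : ι ∘ I = i := funext hI
  obtain rfl : ι ∘ J = j := funext hJ
  have himage (f : Fin r → V) : univ.image (ι ∘ f) = (univ.image f).map ι.toEmbedding := by
    rw [map_eq_image, image_image]
    rfl
  rw [himage, map_mem_toGraph] at hjE ⊢
  exact hS.image_mem (fun _ _ h => ι.lt_iff_lt.1 (hi h)) (fun _ _ h => ι.lt_iff_lt.1 (hj h))
    (fun p => ι.le_iff_le.1 (hij p)) hjE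

end Graph

section Initial

variable {r : ℕ}

/-- The order embedding of `Fin k` in `ℕ` with range `{1, …, k}`. -/
def succEmb (k : ℕ) : Fin k ↪o ℕ :=
  OrderEmbedding.ofStrictMono (fun i => i + 1) fun _ _ h => Nat.succ_lt_succ h

lemma map_succEmb_univ (k : ℕ) : univ.map (succEmb k).toEmbedding = Icc 1 k := by
  ext i
  simp only [succEmb, mem_map, mem_univ, true_and, mem_Icc]
  refine ⟨?_, fun hi => ⟨⟨i - 1, by omega⟩, Nat.sub_add_cancel hi.1⟩⟩
  rintro ⟨a, rfl⟩
  exact ⟨Nat.succ_pos _, a.2⟩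

lemma initial_eq_toGraph (r k : ℕ) : RGraph.initial r k = toGraph (succEmb k).toEmbedding
    ((univ : Finset (Fin k)).powersetCard r) (Set.sized_powersetCard univ r) := by
  simp only [RGraph.initial, RGraph.complete, toGraph, ← map_succEmb_univ, powersetCard_map]

lemma weight_powersetCard_le_lagrangian_initial {k : ℕ} {x : Fin k → ℝ}
    (hx : x ∈ stdSimplex ℝ (Fin k)) :
    weight (univ.powersetCard r) x ≤ (RGraph.initial r k).lagrangian := by
  rw [initial_eq_toGraph]
  exact weight_le_lagrangian _ _ hx

lemma lagrangian_initial_pos {k : ℕ} (hk : k ≠ 0) (hr : r ≤ k) :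
    0 < (RGraph.initial r k).lagrangian := by
  have hpos : (0 : ℝ) < k := Nat.cast_pos.2 (Nat.pos_of_ne_zero hk)
  refine lt_of_lt_of_le ?_ (weight_powersetCard_le_lagrangian_initial (x := fun _ => (k : ℝ)⁻¹)
    ⟨fun _ => by positivity, by simp [hpos.ne']⟩)
  exact sum_pos (fun e _ => prod_pos fun _ _ => by positivity)
    (powersetCard_nonempty.2 (by simpa using hr))

variable {V : Type*} [Fintype V] {E : Finset (Finset V)} {x : V → ℝ}

lemma weight_le_lagrangian_initial (hE : (E : Set (Finset V)).Sized r)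
    (hx : x ∈ stdSimplex ℝ V) :
    weight E x ≤ (RGraph.initial r #(positiveSupport x)).lagrangian := by
  obtain ⟨ι, -, hι⟩ := exists_embedding_antitone x rfl
  have hzero : ∀ i ∉ Set.range ι, x i = 0 := by
    rw [hι]
    exact fun i hi => eq_zero_of_notMem_positiveSupport hx.1 hi
  rw [← weight_trace_of_eq_zero hzero]
  have hmem := comp_mem_stdSimplex hx hzero
  exact (weight_mono (fun f hf => mem_powersetCard_univ.2 (sized_trace hE hf)) hmem.1).trans
    (weight_powersetCard_le_lagrangian_initial hmem)

lemma weight_lt_lagrangian_initial (hE : (E : Set (Finset V)).Sized r)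
    (hx : x ∈ stdSimplex ℝ V) (hclique : ¬ ContainsClique r #(positiveSupport x) E) :
    weight E x < (RGraph.initial r #(positiveSupport x)).lagrangian := by
  classical
  obtain ⟨f, hf, hfE⟩ := not_subset.1 fun hsub => hclique ⟨positiveSupport x, rfl, hsub⟩
  rw [mem_powersetCard] at hf
  calc weight E x < ∏ i ∈ f, x i + weight E x :=
        lt_add_of_pos_left _ (prod_pos fun i hi => mem_positiveSupport.1 (hf.1 hi))
    _ = weight (insert f E) x := (weight_insert hfE x).symm
    _ ≤ _ := weight_le_lagrangian_initial (sized_insert hE hf.2) hx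

end Initial

/-! ### The clique bound -/

section CliqueBound

lemma choose_add_choose_lt {l : ℕ} (hl : 4 ≤ l) :
    (l - 1).choose 3 + (l - 2).choose 2 < l.choose 3 := by
  obtain ⟨q, rfl⟩ : ∃ q, l = q + 2 := ⟨l - 2, by omega⟩
  have hcube : (q + 2).choose 3 = (q + 1).choose 2 + (q + 1).choose 3 := Nat.choose_succ_succ' _ _
  have hsquare : (q + 1).choose 2 = q.choose 1 + q.choose 2 := Nat.choose_succ_succ' _ _
  rw [Nat.choose_one_right] at hsquare
  simp only [Nat.add_sub_cancel, Nat.succ_sub_one]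
  omega

lemma Shifted.bot_mem_pairLink {V : Type*} [LinearOrder V] [Fintype V] [OrderBot V]
    {E : Finset (Finset V)} {a b : V} (hS : Shifted E) (hE : (E : Set (Finset V)).Sized 3)
    (hab : a ≠ b) (ha : ⊥ ≠ a) (hb : ⊥ ≠ b) (hcov : ∃ e ∈ E, a ∈ e ∧ b ∈ e) :
    ⊥ ∈ pairLink E a b := by
  obtain ⟨e, he, hae, hbe⟩ := hcov
  have hbe' : b ∈ e.erase a := mem_erase.2 ⟨hab.symm, hbe⟩
  obtain ⟨w, hw⟩ : ∃ w, (e.erase a).erase b = {w} :=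
    card_eq_one.1 (by rw [card_erase_of_mem hbe', card_erase_of_mem hae, hE he])
  obtain ⟨hwb, hwa, -⟩ : w ≠ b ∧ w ≠ a ∧ w ∈ e := by
    simpa only [mem_erase] using hw.ge (mem_singleton_self w)
  refine hS.mem_pairLink_of_le (mem_pairLink.2 ⟨?_, hab, hwa.symm, hwb.symm⟩) bot_le ha hb
  rwa [← hw, insert_erase hbe', insert_erase hae]

lemma IsCompressedExtremal.card_eq_and_missing_nonempty {V : Type*} [LinearOrder V] [Fintype V]
    [BoundedOrder V] {l : ℕ} {E : Finset (Finset V)} {x : V → ℝ} {u : V}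
    (h : IsCompressedExtremal 3 ((l - 1).choose 3 + (l - 2).choose 2) E x) (hl : 5 ≤ l)
    (hV : l ≤ Fintype.card V) (hu : u ⋖ ⊤) (hbot : ⊥ ∈ pairLink E u ⊤) :
    Fintype.card V = l ∧ #E = (l - 1).choose 3 + (l - 2).choose 2 ∧ (missing 3 E ⊤).Nonempty := by
  have hchoose := choose_add_choose_lt (by omega : 4 ≤ l)
  obtain rfl : l = Fintype.card V := by
    refine hV.eq_of_not_lt fun hlt => ?_
    have hdense := h.choose_le_card (by omega) hu hbot
    have hle := h.card_le
    have hmono : l.choose 3 ≤ (Fintype.card V - 1).choose 3 := Nat.choose_le_choose 3 (by omega)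
    omega
  refine ⟨rfl, h.card_eq h.pos hchoose, nonempty_iff_ne_empty.2 fun hmissing => ?_⟩
  exact (h.choose_add_choose_lt_card hu hbot hmissing).not_ge h.card_le

lemma missing_eq_empty_of_isSubgraph {r n : ℕ} {E : Finset (Finset (Fin (n + 1)))}
    {hE : (E : Set (Finset (Fin (n + 1)))).Sized r}
    (h : (RGraph.initial r n).IsSubgraph (toGraph (succEmb (n + 1)).toEmbedding E hE)) :
    missing r E ⊤ = ∅ := by
  refine eq_empty_of_forall_notMem fun f hf => ?_
  obtain ⟨hcard, htop, hfE⟩ := mem_missing.1 hf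
  refine hfE (map_mem_toGraph.1 (h.2 (mem_powersetCard.2 ⟨fun a ha => ?_, ?_⟩)))
  · obtain ⟨i, hi, rfl⟩ := mem_map.1 ha
    have hlt : i < Fin.last n := lt_top_iff_ne_top.2 (ne_of_mem_of_not_mem hi htop)
    exact mem_Icc.2 ⟨Nat.succ_pos i, hlt⟩
  · exact (card_map _).trans hcard

variable {V : Type*} [Fintype V] {l : ℕ} {E : Finset (Finset V)} {x : V → ℝ}

lemma IsExtremal.exists_leftCompressed
    (h : IsExtremal 3 ((l - 1).choose 3 + (l - 2).choose 2) E x) (hcov : PairCovered E x)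
    (hl : 5 ≤ l) (hsupp : l ≤ #(positiveSupport x)) :
    ∃ G : RGraph 3 ℕ, G.verts = Icc 1 l ∧ G.LeftCompressed ∧
      #G.edges = (l - 1).choose 3 + (l - 2).choose 2 ∧
      ¬ (RGraph.initial 3 (l - 1)).IsSubgraph G ∧ weight E x ≤ G.lagrangian := by
  obtain ⟨n, hn⟩ : ∃ n, #(positiveSupport x) = n + 2 := ⟨_, (Nat.sub_add_cancel (by omega)).symm⟩
  obtain ⟨ι, hanti, hι⟩ := exists_embedding_antitone x hn
  have hιpos (w) : 0 < x (ι w) := mem_positiveSupport.1 (mem_coe.1 (hι ▸ Set.mem_range_self w))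
  have hzero : ∀ i ∉ Set.range ι, x i = 0 := by
    rw [hι]
    exact fun i hi => eq_zero_of_notMem_positiveSupport h.nonneg hi
  let u : Fin (n + 2) := (Fin.last n).castSucc
  have hu : u ⋖ ⊤ := Fin.covBy_iff.2 (Order.covBy_add_one n)
  have hbotu : ⊥ ≠ u := (Fin.mk_lt_mk.2 (by omega : 0 < n)).ne
  have hcov' : ∃ f ∈ trace ι E, u ∈ f ∧ ⊤ ∈ f := by
    obtain ⟨e, he, hue, htope, hpos⟩ :=
      hcov (ι u) (ι ⊤) (ι.injective.ne hu.ne) (hιpos u) (hιpos ⊤)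
    obtain ⟨f, rfl⟩ := exists_map_eq (ι := ι) fun i hi =>
      hι.ge (mem_coe.2 (mem_positiveSupport.2 (hpos i hi)))
    exact ⟨f, mem_trace.2 he, (mem_map' ι).1 hue, (mem_map' ι).1 htope⟩
  obtain ⟨F, hF, hcovF⟩ := (h.comp hzero).exists_isCompressedExtremal hιpos hanti hu.ne hcov'
  obtain ⟨hcard, hFcard, hmissing⟩ := hF.card_eq_and_missing_nonempty hl
    (by rwa [Fintype.card_fin, ← hn]) hu
    (hF.shifted.bot_mem_pairLink hF.sized hu.ne hbotu bot_ne_top hcovF)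
  obtain rfl : n + 2 = l := (Fintype.card_fin _).symm.trans hcard
  refine ⟨toGraph (succEmb _).toEmbedding F hF.sized, map_succEmb_univ _,
    toGraph_leftCompressed _ _ hF.shifted, (card_map _).trans hFcard,
    fun hsub => hmissing.ne_empty (missing_eq_empty_of_isSubgraph hsub), ?_⟩
  rw [← weight_trace_of_eq_zero hzero, (h.comp hzero).weight_eq hF.toIsExtremal]
  exact weight_le_lagrangian _ _ hF.mem_stdSimplex

lemma weight_lt_of_cliqueFree
    (hcheck : ∀ G : RGraph 3 ℕ, G.verts = Icc 1 l → G.LeftCompressed →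
      #G.edges = (l - 1).choose 3 + (l - 2).choose 2 →
      ¬ (RGraph.initial 3 (l - 1)).IsSubgraph G →
      G.lagrangian < (RGraph.initial 3 (l - 1)).lagrangian)
    (hl : 5 ≤ l) (hV : l ≤ Fintype.card V) (hE : (E : Set (Finset V)).Sized 3)
    (hcard : #E ≤ (l - 1).choose 3 + (l - 2).choose 2) (hclique : ¬ ContainsClique 3 (l - 1) E)
    (hx : x ∈ stdSimplex ℝ V) : weight E x < (RGraph.initial 3 (l - 1)).lagrangian := by
  by_contra! hle
  have hsupp {F : Finset (Finset V)} {y : V → ℝ}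
      (hF : IsExtremal 3 ((l - 1).choose 3 + (l - 2).choose 2) F y) (hcov : PairCovered F y) :
      #(positiveSupport y) = l - 1 := by
    have hFle := hle.trans (hF.weight_le E hE hcard x hx)
    have hpos := (lagrangian_initial_pos (r := 3) (k := l - 1) (by omega) (by omega)).trans_le hFle
    refine le_antisymm (not_lt.1 fun hlt => ?_)
      (hF.le_card_positiveSupport (by norm_num) (Nat.le_add_right _ _) (by omega) hpos)
    obtain ⟨G, hverts, hcomp, hedges, hsub, hG⟩ := hF.exists_leftCompressed hcov hl (by omega)
    exact (hFle.trans hG).not_gt (hcheck G hverts hcomp hedges hsub)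
  have : Nonempty V := Fintype.card_pos_iff.1 (by omega)
  obtain ⟨F, y, hFy⟩ := exists_isExtremal (V := V) 3 ((l - 1).choose 3 + (l - 2).choose 2)
  obtain ⟨z, hFz, hcovF⟩ := hFy.exists_pairCovered
  have hFle := hsupp hFz hcovF ▸ weight_le_lagrangian_initial hFz.sized hFz.mem_stdSimplex
  have hEx := hFz.of_weight_le hE hcard hx (hFle.trans hle)
  obtain ⟨w, hEw, hcovE⟩ := hEx.exists_pairCovered
  have hlt := weight_lt_lagrangian_initial hE hEw.mem_stdSimplex
    ((hsupp hEw hcovE).symm ▸ hclique)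
  rw [hsupp hEw hcovE, ← hEx.weight_eq hEw] at hlt
  exact hlt.not_ge hle

end CliqueBound

section Lagrangian

variable {r : ℕ} {α : Type*} (G : RGraph r α)

lemma sized_edges : (G.edges : Set (Finset α)).Sized r :=
  fun _ he => (mem_powersetCard.1 (G.edges_sub he)).2

lemma lagrangian_lt_of_forall_weight_lt (hG : G.verts.Nonempty) {c : ℝ}
    (h : ∀ x ∈ stdSimplex ℝ G.verts, weight (trace (.subtype (· ∈ G.verts)) G.edges) x < c) :
    G.lagrangian < c := by
  set E := trace (.subtype (· ∈ G.verts)) G.edges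
  have := hG.to_subtype
  classical
  obtain ⟨x, hx, hmax⟩ := (isCompact_stdSimplex ℝ G.verts).exists_isMaxOn
    ⟨_, single_mem_stdSimplex ℝ (Classical.arbitrary G.verts)⟩ (continuous_weight E).continuousOn
  refine (Real.sSup_le ?_ (weight_nonneg hx.1)).trans_lt (h x hx)
  rintro _ ⟨y, hy, rfl⟩
  have hyG : y ∘ Subtype.val ∈ stdSimplex ℝ G.verts :=
    ⟨fun v => hy.1 v v.2, (sum_coe_sort G.verts y).trans hy.2⟩
  have hweight : weight E (y ∘ Subtype.val) = G.weightPoly y := by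
    refine weight_trace (ι := .subtype (· ∈ G.verts)) fun e he ⟨i, hi, hrange⟩ =>
      absurd ⟨⟨i, (mem_powersetCard.1 (G.edges_sub he)).1 hi⟩, rfl⟩ hrange
  exact hweight.symm.trans_le (hmax hyG)

lemma hasClique_of_mem_edges {e : Finset α} (he : e ∈ G.edges) : G.HasClique r := by
  obtain ⟨hsub, hcard⟩ := mem_powersetCard.1 (G.edges_sub he)
  refine ⟨e, hcard, hsub, ?_⟩
  intro f hf
  obtain ⟨hfe, hfcard⟩ := mem_powersetCard.1 hf
  rwa [eq_of_subset_of_card_le hfe (hcard.trans hfcard.symm).le]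

end Lagrangian

end HypergraphLagrangian

open Finset HypergraphLagrangian in
theorem theorem1p9_general (l : ℕ)
    (hcheck : ∀ G : RGraph 3 ℕ, G.verts = Icc 1 l → G.LeftCompressed →
      #G.edges = (l - 1).choose 3 + (l - 2).choose 2 →
      ¬ (RGraph.initial 3 (l - 1)).IsSubgraph G →
      G.lagrangian < (RGraph.initial 3 (l - 1)).lagrangian)
    {α : Type u} (G : RGraph 3 α) (hG : G.edges.Nonempty)
    (hcard : #G.edges ≤ (l - 1).choose 3 + (l - 2).choose 2) (hclique : ¬ G.HasClique (l - 1)) :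
    G.lagrangian < (RGraph.initial 3 (l - 1)).lagrangian := by
  obtain ⟨e, he⟩ := hG
  rcases lt_or_ge l 5 with hl | hl
  · have hpos : 0 < (l - 1).choose 3 + (l - 2).choose 2 := (card_pos.2 ⟨e, he⟩).trans_le hcard
    obtain rfl : l = 4 := by
      interval_cases l <;> simp_all [Nat.choose]
    exact absurd (hasClique_of_mem_edges G he) hclique
  obtain ⟨v, hv⟩ : e.Nonempty := card_pos.1 ((sized_edges G he).symm ▸ three_pos)
  refine lagrangian_lt_of_forall_weight_lt G ⟨v, (mem_powersetCard.1 (G.edges_sub he)).1 hv⟩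
    fun x hx => ?_
  -- The extra isolated vertices make sure that there are at least `l` vertices.
  let ι : G.verts ↪ G.verts ⊕ Fin l := .inl
  rw [← Function.extend_comp ι.injective x 0, ← weight_map]
  exact weight_lt_of_cliqueFree hcheck hl (by simp) (sized_map ι (sized_trace (sized_edges G)))
    ((card_map _).trans_le ((card_trace_le _ _).trans hcard))
    (fun h => hclique (hasClique_of_containsClique (h.of_map three_ne_zero (by omega))))
    (extend_mem_stdSimplex ι hx)

theorem theorem1p9 (l : ℕ)
    (hcheck : ∀ G : RGraph 3 ℕ, G.verts = Finset.Icc 1 l → G.LeftCompressed →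
      G.edges.card = (l - 1).choose 3 + (l - 2).choose 2 →
      ¬ (RGraph.initial 3 (l - 1)).IsSubgraph G →
      G.lagrangian < (RGraph.initial 3 (l - 1)).lagrangian)
    {α : Type u} (m : ℕ) (hm : 0 < m)
    (hlow : (l - 1).choose 3 ≤ m) (hupp : m ≤ (l - 1).choose 3 + (l - 2).choose 2)
    (G : RGraph 3 α) (hcard : G.edges.card = m) (hclique : ¬ G.HasClique (l - 1)) :
    G.lagrangian < (RGraph.initial 3 (l - 1)).lagrangian :=
  theorem1p9_general l hcheck G (Finset.card_pos.1 (hcard ▸ hm)) (hcard ▸ hupp) hclique
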